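/- Let $n\ge 3$ and regard $[n]=\{1,\dots,n\}$ as the vertices of a convex $n$-gon in cyclic order; edges are the elements of $\binom{[n]}2$, and an edge is a side if its end-points are cyclically consecutive and a diagonal otherwise. Let $\mathcal V^+_1(n)\subset\mathbb R^{\binom{[n]}2}$ be the set of all $v$ such that for all $a<a'<b<b'$ in $[n]$ the maximum of $v_{a,b}+v_{a',b'}$, $v_{a,a'}+v_{b,b'}$, $v_{a,b'}+v_{a',b}$ is attained at least twice and is attained by the first one. Let $G\subset\mathbb R^{\binom{[n]}2}$ be the convex cone of all $v$ for which the first of these three sums is always a maximal one. For an edge $e$ let $W_e\in\mathbb R^{\binom{[n]}2}$ be the $0/1$-vector whose entry at $\{a,b\}$, $a<b$, is $1$ if and only if exactly one end-point of $e$ lies in $\{a,a+1,\dots,b-1\}$. Let $T\subset\binom{[n]}2$ be any triangulation of the $n$-gon (an inclusion-maximal set of pairwise non-crossing edges, sides included), let $\overline T\subset T$ be its set of diagonals, and let $\pi:\mathbb R^{\binom{[n]}2}\to\mathbb R^T$ be the coordinate projection. Then: 1. $|T|=2n-3$, and $\pi$ is injective on $\mathcal V^+_1(n)$. 2. $\mathcal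 V^+_1(n)$ is the union of the faces of $G$ that it contains. Moreover $|\overline T|=n-3$, and there is exactly one linear map $\phi:\mathbb R^T\to\mathbb R^{\overline T}$ with $\phi(\pi(W_e))=0$ for every side $e$ and with $\phi(\pi(W_\delta))$ equal to the standard basis vector indexed by $\delta$ for every $\delta\in\overline T$. 3. For every surjective linear map $\phi:\mathbb R^T\to\mathbb R^{\overline T}\cong\mathbb R^{n-3}$ with $\phi(\pi(W_e))=0$ for every side $e$ (in particular for the one in 2), the images under $\phi\circ\pi$ of the faces of $G$ contained in $\mathcal V^+_1(n)$ form a complete simplicial fan in $\mathbb R^{\overline T}$. This fan realizes the associahedron: sending a set $D$ of pairwise non-crossing diagonals (possibly empty) to the cone generated by the vectors $\phi(\pi(W_e))$, $e\in D$, is an inclusion-preserving and inclusion-reflecting bijection from all such sets $D$ to the cones of the fan. -/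

import Mathlib

namespace PfaffianFan

/-! ### Edges, crossings, triangulations -/

/-- Edges of the complete graph on the vertices `0, …, n - 1` of a convex `n`-gon, i.e. two-element
subsets of the vertex set, written as pairs `(i, j)` with `i < j`. -/
abbrev Edge (n : ℕ) : Type := {p : Fin n × Fin n // p.1 < p.2}

/-- `v` is one of the two end-points of `e`. -/
def Edge.HasEnd {n : ℕ} (e : Edge n) (v : Fin n) : Prop := v = e.1.1 ∨ v = e.1.2

/-- Two edges of a convex polygon cross. -/
def Crosses {n : ℕ} (e f : Edge n) : Prop :=
  (e.1.1 < f.1.1 ∧ f.1.1 < e.1.2 ∧ e.1.2 < f.1.2) ∨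
    (f.1.1 < e.1.1 ∧ e.1.1 < f.1.2 ∧ f.1.2 < e.1.2)

/-- The edges of `S` mutually cross. -/
def MutuallyCrossing {n : ℕ} (S : Finset (Edge n)) : Prop :=
  (S : Set (Edge n)).Pairwise Crosses

/-- `S` is `m`-free: it contains no `m`-crossing, i.e. no set of `m` mutually crossing edges. -/
def IsFree {n : ℕ} (m : ℕ) (S : Finset (Edge n)) : Prop :=
  ∀ R ⊆ S, MutuallyCrossing R → R.card ≠ m

/-- A `k`-triangulation is an inclusion-maximal `(k + 1)`-free set of edges. For `k = 1` these are
the triangulations of the `n`-gon (its `n` boundary sides included). -/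
def IsTriangulation {n : ℕ} (k : ℕ) (T : Finset (Edge n)) : Prop :=
  Maximal (IsFree (k + 1)) T

/-- An edge is relevant if the cyclic distance of its end-points is larger than `k`. For `k = 1`
the relevant edges are the diagonals and the irrelevant ones the sides of the `n`-gon. -/
def IsRelevant {n : ℕ} (k : ℕ) (e : Edge n) : Prop :=
  (e.1.1 : ℕ) + k < e.1.2 ∧ (e.1.2 : ℕ) + k < e.1.1 + n

instance {n : ℕ} (k : ℕ) : DecidablePred (IsRelevant (n := n) k) := fun e =>
  inferInstanceAs (Decidable ((e.1.1 : ℕ) + k < e.1.2 ∧ (e.1.2 : ℕ) + k < e.1.1 + n))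

/-- The relevant part of a set of edges. -/
def relevantPart {n : ℕ} (k : ℕ) (T : Finset (Edge n)) : Finset (Edge n) :=
  T.filter (IsRelevant k)

/-- The faces, the empty one included, of the multiassociahedron: the `(k + 1)`-free sets of
relevant edges, ordered by inclusion. For `k = 1` it is the (boundary complex of the polar of the)
associahedron: the non-crossing sets of diagonals of the `n`-gon. -/
abbrev Associahedron (k n : ℕ) : Type :=
  {D : Finset (Edge n) // (∀ e ∈ D, IsRelevant k e) ∧ IsFree (k + 1) D}

/-! ### Matchings and the tropical Pfaffian prevariety -/

/-- `M` is a perfect matching of the vertex set `U`. Perfect matchings of `U` are the monomials of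
the Pfaffian of the submatrix with rows and columns in `U`. -/
def IsMatching {n : ℕ} (U : Finset (Fin n)) (M : Finset (Edge n)) : Prop :=
  (∀ e ∈ M, e.1.1 ∈ U ∧ e.1.2 ∈ U) ∧ ∀ u ∈ U, ∃! e, e ∈ M ∧ e.HasEnd u

/-- The weight that `v` gives to a set of edges. -/
def weight {n : ℕ} (v : Edge n → ℝ) (M : Finset (Edge n)) : ℝ := ∑ e ∈ M, v e

/-- The tropical Pfaffian prevariety: the weight vectors for which, for every set `U` of `2k + 2`
vertices, the maximal weight of a perfect matching of `U` is attained at least twice. -/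
def tropPfaffian (k n : ℕ) : Set (Edge n → ℝ) :=
  {v | ∀ U : Finset (Fin n), U.card = 2 * k + 2 →
    ∃ M₁ M₂ : Finset (Edge n), M₁ ≠ M₂ ∧ IsMatching U M₁ ∧ IsMatching U M₂ ∧
      weight v M₁ = weight v M₂ ∧ ∀ M, IsMatching U M → weight v M ≤ weight v M₁}

/-- The Gröbner cone: the weight vectors for which, for every set `U` of `2k + 2` vertices, the
perfect matching of `U` that is a `(k + 1)`-crossing has maximal weight. -/
def grobnerCone (k n : ℕ) : PointedCone ℝ (Edge n → ℝ) where
  carrier := {v | ∀ U : Finset (Fin n), U.card = 2 * k + 2 →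
    ∀ M₀, IsMatching U M₀ → MutuallyCrossing M₀ →
      ∀ M, IsMatching U M → weight v M ≤ weight v M₀}
  add_mem' := by
    intro v w hv hw U hU M₀ h₀ hc M hM
    have h1 := hv U hU M₀ h₀ hc M hM
    have h2 := hw U hU M₀ h₀ hc M hM
    simp only [weight, Pi.add_apply, Finset.sum_add_distrib] at *
    linarith
  zero_mem' := by
    intro U hU M₀ h₀ hc M hM
    simp [weight]
  smul_mem' := by
    intro c v hv U hU M₀ h₀ hc M hM
    have h1 := mul_le_mul_of_nonneg_left (hv U hU M₀ h₀ hc M hM) c.2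
    simp only [weight, Finset.mul_sum] at h1
    exact h1

/-- The `(k + 1)`-free part of the tropical Pfaffian prevariety. -/
def tropPfaffianPlus (k n : ℕ) : Set (Edge n → ℝ) :=
  tropPfaffian k n ∩ (grobnerCone k n : Set (Edge n → ℝ))

/-- The cones of the fan structure of the `(k + 1)`-free part: the faces of the Gröbner cone
contained in it. -/
def tropPfaffianPlusFan (k n : ℕ) : Set (PointedCone ℝ (Edge n → ℝ)) :=
  {F | F.IsFaceOf (grobnerCone k n) ∧ (F : Set (Edge n → ℝ)) ⊆ tropPfaffianPlus k n}

/-! ### Separation vectors -/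

/-- The edge `e` separates the sides `{a - 1, a}` and `{b - 1, b}` (indices modulo `n`) of the
`n`-gon, where `s = (a, b)`: exactly one of its end-points lies in `{a, …, b - 1}`. -/
def Separates {n : ℕ} (e s : Edge n) : Prop :=
  Xor (s.1.1 ≤ e.1.1 ∧ e.1.1 < s.1.2) (s.1.1 ≤ e.1.2 ∧ e.1.2 < s.1.2)

open Classical in
/-- The separation vector of `w`: its entry at `{a, b}` is the sum of the `w e` over all edges `e`
separating the `a`-th from the `b`-th side. -/
noncomputable def separationVector {n : ℕ} (w : Edge n → ℝ) : Edge n → ℝ :=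
  fun s => ∑ e : Edge n, if Separates e s then w e else 0

/-- The separation vector of the indicator vector of a single edge. -/
noncomputable def edgeGenerator {n : ℕ} (e : Edge n) : Edge n → ℝ :=
  separationVector (Pi.single e 1)

/-! ### Projections and fans -/

/-- The coordinate projection keeping the entries indexed by `T`. -/
def coordProj {n : ℕ} (T : Finset (Edge n)) : (Edge n → ℝ) →ₗ[ℝ] (T → ℝ) :=
  LinearMap.funLeft ℝ ℝ (Subtype.val : T → Edge n)

/-- A finite family of cones is a complete simplicial fan: every cone is spanned by linearly
independent vectors, faces of cones of the family are in the family, any two cones meet in a common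
face, and the cones cover the whole space. -/
structure IsCompleteSimplicialFan {V : Type*} [AddCommGroup V] [Module ℝ V]
    (S : Set (PointedCone ℝ V)) : Prop where
  finite : S.Finite
  simplicial : ∀ C ∈ S, C.IsSimplicial
  face_mem : ∀ C ∈ S, ∀ F : PointedCone ℝ V, F.IsFaceOf C → F ∈ S
  inter_isFaceOf : ∀ C ∈ S, ∀ C' ∈ S, (C ⊓ C').IsFaceOf C
  complete : ∀ x : V, ∃ C ∈ S, x ∈ C

end PfaffianFan

namespace PfaffianFan

/-! The separation vectors of all edges form a basis of the whole space, and the positive part is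
simple in these coordinates. The generator of `e` is the split pseudometric `(arc e i - arc e j) ^
2`, so its coefficient in a weight vector is recovered by a mixed second difference, `isolationMap`.
The defects of the two inequalities for a quadrangle are twice sums of coefficients over two sets of
diagonals, and each diagonal of the one set crosses each of the other. Hence the Gröbner cone
consists of the vectors with nonnegative diagonal coefficients and arbitrary side coefficients, and
the positive part is cut out by the condition that no two crossing diagonals have nonzero
coefficients (`separationVector_mem_tropPfaffianPlus_iff`). The faces inside it are the cones
`coneOf D` with `D` non-crossing.

On the other hand the positive part is the solution set of the tropical Ptolemy relations. By
induction over ears, a solution is determined by its values on a triangulation `T`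
(`ptolemy_unique`), and these values are arbitrary (`exists_ptolemy`). So the projection to `T` is a
bijection from the positive part onto the full coordinate space.

Injectivity makes the projected generators of the sides independent. A surjective `φ` that kills
them has a kernel of dimension `(2n - 3) - (n - 3) = n`, the number of sides, so its kernel is their
span. Therefore conic combinations over non-crossing sets of diagonals keep unique coefficients
under `φ` (`hasUniqueConicRep`), which gives simplicial cones meeting in common faces and the
isomorphism with the associahedron. Surjectivity gives completeness. -/

/-! ### The tropical Ptolemy relations -/

/-- The tropical Ptolemy relation for four points. -/
def Ptolemy {α : Type*} (d : α → α → ℝ) (i j k l : α) : Prop :=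
  d i k + d j l = max (d i j + d k l) (d i l + d j k)

/-- The tropical Ptolemy relations for all quadrangles with vertices in `S`. -/
def IsPtolemy {n : ℕ} (S : Finset (Fin n)) (d : Fin n → Fin n → ℝ) : Prop :=
  ∀ i ∈ S, ∀ j ∈ S, ∀ k ∈ S, ∀ l ∈ S, i < j → j < k → k < l → Ptolemy d i j k l

/-- Four vertices in cyclic order. -/
def Cyclic {n : ℕ} (i j k l : Fin n) : Prop :=
  (i < j ∧ j < k ∧ k < l) ∨ (j < k ∧ k < l ∧ l < i) ∨ (k < l ∧ l < i ∧ i < j) ∨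
    (l < i ∧ i < j ∧ j < k)

theorem Ptolemy.rotate {α : Type*} {d : α → α → ℝ} (hd : ∀ i j, d i j = d j i) {i j k l : α}
    (h : Ptolemy d i j k l) : Ptolemy d j k l i := by
  unfold Ptolemy at *
  rw [hd k i, hd l i, hd j i, max_comm, add_comm, h, add_comm (d j k)]

theorem Cyclic.rotate {n : ℕ} {i j k l : Fin n} (h : Cyclic i j k l) : Cyclic j k l i := by
  unfold Cyclic at *
  tauto

theorem IsPtolemy.cyclic {n : ℕ} {S : Finset (Fin n)} {d : Fin n → Fin n → ℝ}
    (h : IsPtolemy S d) (hd : ∀ i j, d i j = d j i) {i j k l : Fin n} (hi : i ∈ S) (hj : j ∈ S)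
    (hk : k ∈ S) (hl : l ∈ S) (hc : Cyclic i j k l) : Ptolemy d i j k l := by
  rcases hc with ⟨h1, h2, h3⟩ | ⟨h1, h2, h3⟩ | ⟨h1, h2, h3⟩ | ⟨h1, h2, h3⟩
  · exact h i hi j hj k hk l hl h1 h2 h3
  · exact (((h j hj k hk l hl i hi h1 h2 h3).rotate hd).rotate hd).rotate hd
  · exact ((h k hk l hl i hi j hj h1 h2 h3).rotate hd).rotate hd
  · exact (h l hl i hi j hj k hk h1 h2 h3).rotate hd

/-- The relation is invariant under rotation of the quadrangle, so a quadrangle containing `p` can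
be turned until `p` comes first. -/
theorem isPtolemy_of_forall_mem {n : ℕ} {S : Finset (Fin n)} {d : Fin n → Fin n → ℝ} {p : Fin n}
    (hd : ∀ i j, d i j = d j i) (h : IsPtolemy (S.erase p) d)
    (hp : ∀ u ∈ S.erase p, ∀ v ∈ S.erase p, ∀ w ∈ S.erase p, Cyclic p u v w → Ptolemy d p u v w) :
    IsPtolemy S d := by
  intro i hi j hj k hk l hl h1 h2 h3
  have mem : ∀ {x}, x ∈ S → x ≠ p → x ∈ S.erase p := fun hx hne => Finset.mem_erase.2 ⟨hne, hx⟩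
  have hc : Cyclic i j k l := Or.inl ⟨h1, h2, h3⟩
  by_cases ei : i = p
  · subst ei
    exact hp j (mem hj h1.ne') k (mem hk (h1.trans h2).ne') l
      (mem hl ((h1.trans h2).trans h3).ne') hc
  by_cases ej : j = p
  · subst ej
    exact (((hp k (mem hk h2.ne') l (mem hl (h2.trans h3).ne') i (mem hi h1.ne)
      hc.rotate).rotate hd).rotate hd).rotate hd
  by_cases ek : k = p
  · subst ek
    exact ((hp l (mem hl h3.ne') i (mem hi (h1.trans h2).ne) j (mem hj h2.ne)
      hc.rotate.rotate).rotate hd).rotate hd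
  by_cases el : l = p
  · subst el
    exact (hp i (mem hi ((h1.trans h2).trans h3).ne) j (mem hj (h2.trans h3).ne) k
      (mem hk h3.ne) hc.rotate.rotate.rotate).rotate hd
  exact h i (mem hi ei) j (mem hj ej) k (mem hk ek) l (mem hl el) h1 h2 h3

/-! ### Triangulations of sub-polygons and ears -/

/-- `T` is a triangulation of the polygon with vertex set `S`. -/
structure IsTriangulationOf {n : ℕ} (S : Finset (Fin n)) (T : Finset (Edge n)) : Prop where
  mem : ∀ e ∈ T, e.1.1 ∈ S ∧ e.1.2 ∈ S
  not_crosses : ∀ e ∈ T, ∀ f ∈ T, ¬ Crosses e f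
  maximal : ∀ e : Edge n, e.1.1 ∈ S → e.1.2 ∈ S → (∀ f ∈ T, ¬ Crosses e f) → e ∈ T

/-- The edge with given end-points. -/
abbrev Edge.mk {n : ℕ} {i j : Fin n} (h : i < j) : Edge n := ⟨(i, j), h⟩

/-- The vertex `p` of the polygon with vertex set `S` is an ear of the triangulation `T`, its
neighbours being `a < p` and `b > p`. -/
structure IsEar {n : ℕ} (S : Finset (Fin n)) (T : Finset (Edge n)) (a p b : Fin n) : Prop where
  lt_mid : a < p
  mid_lt : p < b
  left_mem : Edge.mk lt_mid ∈ T
  right_mem : Edge.mk mid_lt ∈ T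
  base_mem : Edge.mk (lt_mid.trans mid_lt) ∈ T
  eq_mid : ∀ c ∈ S, a < c → c < b → c = p

namespace IsTriangulationOf

variable {n : ℕ} {S : Finset (Fin n)} {T : Finset (Edge n)}

theorem mk_mem (h : IsTriangulationOf S T) {i j : Fin n} (hij : i < j) (hi : i ∈ S) (hj : j ∈ S)
    (hno : ∀ c ∈ S, ¬ (i < c ∧ c < j)) : Edge.mk hij ∈ T := by
  refine h.maximal _ hi hj fun f hf hc => ?_
  obtain ⟨h1, h2⟩ := h.mem f hf
  have a1 := hno _ h1
  have a2 := hno _ h2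
  unfold Crosses at hc
  dsimp only at hc
  tauto

/-- The triangle of a triangulation below one of its edges. -/
theorem exists_apex (h : IsTriangulationOf S T) {a b : Fin n} (hab : a < b)
    (hT : Edge.mk hab ∈ T) (hc : ∃ c ∈ S, a < c ∧ c < b) :
    ∃ m, ∃ (h1 : a < m) (h2 : m < b), Edge.mk h1 ∈ T ∧ Edge.mk h2 ∈ T := by
  obtain ⟨ha, hb⟩ := h.mem _ hT
  let A := S.filter fun m => m < b ∧ ∃ h1 : a < m, Edge.mk h1 ∈ T
  have hA : A.Nonempty := by
    obtain ⟨c, hcS, hc1, hc2⟩ := hc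
    -- The vertex of `S` following `a` is joined to `a` by a side of the polygon, so it belongs to
    -- `A`.
    have hne : (S.filter fun x => a < x).Nonempty := ⟨c, by simp [hcS, hc1]⟩
    have hm := Finset.min'_mem _ hne
    have hle : ∀ x ∈ S, a < x → (S.filter fun x => a < x).min' hne ≤ x := fun x hx hax =>
      Finset.min'_le _ _ (by simp [hx, hax])
    generalize (S.filter fun x => a < x).min' hne = m at hm hle
    simp only [Finset.mem_filter] at hm
    refine ⟨m, ?_⟩
    simp only [A, Finset.mem_filter]
    refine ⟨hm.1, (hle c hcS hc1).trans_lt hc2, hm.2, h.mk_mem _ ha hm.1 ?_⟩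
    rintro x hx ⟨h1, h2⟩
    exact absurd (hle x hx h1) (not_le.2 h2)
  have hm := Finset.max'_mem _ hA
  have hle : ∀ x ∈ A, x ≤ A.max' hA := fun x hx => Finset.le_max' _ _ hx
  generalize A.max' hA = m at hm hle
  simp only [A, Finset.mem_filter] at hm hle
  obtain ⟨hmS, hmb, ham, hamT⟩ := hm
  refine ⟨m, ham, hmb, hamT, h.maximal _ hmS hb fun f hf hcr => ?_⟩
  have n1 := h.not_crosses _ hT f hf
  have n2 := h.not_crosses _ hamT f hf
  obtain ⟨⟨c, d⟩, hcd⟩ := f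
  have hfS := h.mem _ hf
  unfold Crosses at hcr n1 n2
  dsimp only at hcr n1 n2 hfS hcd
  -- An edge crossing `{m, b}` but neither `{a, b}` nor `{a, m}` starts at `a` and ends strictly
  -- between `m` and `b`, against the maximality of `m`.
  have key : c = a ∧ m < d ∧ d < b := by omega
  obtain ⟨rfl, hmd, hdb⟩ := key
  exact absurd (hle d ⟨hfS.2, hdb, hcd, hf⟩) (not_le.2 hmd)

/-- Every triangulation of a polygon with at least three vertices has an ear. -/
theorem exists_ear (h : IsTriangulationOf S T) (hS : 3 ≤ S.card) :
    ∃ a p b, IsEar S T a p b := by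
  classical
  let A := T.filter fun e => ∃ c ∈ S, e.1.1 < c ∧ c < e.1.2
  have hA : A.Nonempty := by
    have hne : S.Nonempty := Finset.card_pos.1 (by omega)
    have hlt : S.min' hne < S.max' hne := Finset.min'_lt_max'_of_card _ (by omega)
    refine ⟨Edge.mk hlt, ?_⟩
    simp only [A, Finset.mem_filter]
    refine ⟨h.maximal _ (Finset.min'_mem _ hne) (Finset.max'_mem _ hne) fun f hf hc => ?_, ?_⟩
    · obtain ⟨h1, h2⟩ := h.mem f hf
      have l1 := Finset.min'_le _ _ h1
      have l2 := Finset.le_max' _ _ h2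
      unfold Crosses at hc
      dsimp only at hc
      omega
    · by_contra hno
      push Not at hno
      have hsub : S ⊆ {S.min' hne, S.max' hne} := by
        intro c hc
        have l1 := Finset.min'_le _ _ hc
        have l2 := Finset.le_max' _ _ hc
        have l3 := hno c hc
        simp only [Finset.mem_insert, Finset.mem_singleton]
        rcases l1.lt_or_eq with l | l
        · exact Or.inr (le_antisymm l2 (l3 l))
        · exact Or.inl l.symm
      have := (Finset.card_le_card hsub).trans Finset.card_le_two
      omega
  -- Choose a shortest edge of `T` with a vertex below it. The other two edges of the triangle below
  -- it are shorter, so they have no vertex below them, and the apex is an ear.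
  obtain ⟨⟨⟨a, b⟩, hab⟩, he, hmin⟩ :=
    Finset.exists_min_image A (fun e => (e.1.2 : ℕ) - (e.1.1 : ℕ)) hA
  simp only [A, Finset.mem_filter] at he hmin
  dsimp only at hab
  obtain ⟨m, h1, h2, m1, m2⟩ := h.exists_apex hab he.1 he.2
  refine ⟨a, m, b, h1, h2, m1, m2, he.1, fun c hc hac hcb => ?_⟩
  by_contra hne
  rcases lt_or_gt_of_ne hne with hlt | hlt
  · have := hmin _ ⟨m1, c, hc, hac, hlt⟩
    dsimp only at this
    omega
  · have := hmin _ ⟨m2, c, hc, hlt, hcb⟩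
    dsimp only at this
    omega

/-- Cutting off an ear. -/
theorem erase_ear (h : IsTriangulationOf S T) {a p b : Fin n}
    (hE : IsEar S T a p b) : IsTriangulationOf (S.erase p)
      ((T.erase (Edge.mk hE.lt_mid)).erase (Edge.mk hE.mid_lt)) where
  mem := by
    obtain ⟨h1, h2, m1, m2, m3, hear⟩ := hE
    intro e he
    simp only [Finset.mem_erase, ne_eq] at he ⊢
    obtain ⟨he2, he1, heT⟩ := he
    have hS := h.mem e heT
    have hx := h.not_crosses _ m3 e heT
    obtain ⟨⟨c, d⟩, hcd⟩ := e
    simp only [Edge.mk, Subtype.mk.injEq, Prod.mk.injEq] at he2 he1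
    unfold Crosses at hx
    dsimp only at hS hx hcd ⊢
    have hc := hear c hS.1
    have hd := hear d hS.2
    -- Any further edge at `p` would leave the triangle `a, p, b` through its base and cross `{a,
    -- b}`.
    refine ⟨⟨fun e => ?_, hS.1⟩, ⟨fun e => ?_, hS.2⟩⟩
    · subst e
      rcases lt_trichotomy d b with hl | hl | hl
      · exact absurd (hd (h1.trans hcd) hl) hcd.ne'
      · exact he2 ⟨rfl, hl⟩
      · omega
    · subst e
      rcases lt_trichotomy a c with hl | hl | hl
      · exact absurd (hc hl (hcd.trans h2)) hcd.ne
      · exact he1 ⟨hl.symm, rfl⟩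
      · omega
  not_crosses := fun e he f hf =>
    h.not_crosses e (Finset.mem_of_mem_erase (Finset.mem_of_mem_erase he)) f
      (Finset.mem_of_mem_erase (Finset.mem_of_mem_erase hf))
  maximal := by
    obtain ⟨h1, h2, m1, m2, m3, hear⟩ := hE
    intro e he1 he2 hno
    obtain ⟨n1, s1⟩ := Finset.mem_erase.1 he1
    obtain ⟨n2, s2⟩ := Finset.mem_erase.1 he2
    have hc := hear _ s1
    have hd := hear _ s2
    have hcd := e.2
    have neq1 : e ≠ Edge.mk h1 := fun heq => n2 (by rw [heq])
    have neq2 : e ≠ Edge.mk h2 := fun heq => n1 (by rw [heq])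
    refine Finset.mem_erase.2 ⟨neq2, Finset.mem_erase.2 ⟨neq1, h.maximal e s1 s2 fun f hf => ?_⟩⟩
    by_cases hf1 : f = Edge.mk h1
    · subst hf1
      unfold Crosses
      dsimp only
      omega
    by_cases hf2 : f = Edge.mk h2
    · subst hf2
      unfold Crosses
      dsimp only
      omega
    exact hno f (Finset.mem_erase.2 ⟨hf2, Finset.mem_erase.2 ⟨hf1, hf⟩⟩)

/-- Induction over triangulations by cutting off ears. -/
theorem ear_induction {motive : Finset (Fin n) → Finset (Edge n) → Prop}
    (base : ∀ (a b : Fin n) (hab : a < b), motive {a, b} {Edge.mk hab})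
    (step : ∀ S T (a p b : Fin n) (hE : IsEar S T a p b), IsTriangulationOf S T →
      motive (S.erase p) ((T.erase (Edge.mk hE.lt_mid)).erase (Edge.mk hE.mid_lt)) → motive S T)
    (hS : 2 ≤ S.card) (h : IsTriangulationOf S T) : motive S T := by
  obtain ⟨k, hk⟩ : ∃ k, S.card = k := ⟨_, rfl⟩
  induction k generalizing S T with
  | zero => omega
  | succ k ih =>
    rcases hS.eq_or_lt with h2 | h3
    · obtain ⟨a, b, hne, rfl⟩ := Finset.card_eq_two.1 h2.symm
      wlog hab : a < b generalizing a b
      · rw [Finset.pair_comm] at h h2 hk hS ⊢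
        exact this b a hne.symm hS h hk h2 (lt_of_le_of_ne (not_lt.1 hab) hne.symm)
      have hT : T = {Edge.mk hab} := by
        ext e
        rw [Finset.mem_singleton]
        constructor
        · intro he
          have hm := h.mem e he
          obtain ⟨⟨c, d⟩, hcd⟩ := e
          simp only [Finset.mem_insert, Finset.mem_singleton] at hm hcd
          simp only [Edge.mk, Subtype.mk.injEq, Prod.mk.injEq]
          omega
        · rintro rfl
          refine h.mk_mem hab (by simp) (by simp) ?_
          simp only [Finset.mem_insert, Finset.mem_singleton]
          rintro c (rfl | rfl) ⟨h1, h2⟩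
          · exact lt_irrefl _ h1
          · exact lt_irrefl _ h2
      rw [hT]
      exact base a b hab
    · obtain ⟨a, p, b, hE⟩ := h.exists_ear h3
      have hp : p ∈ S := (h.mem _ hE.left_mem).2
      have hc := Finset.card_erase_of_mem hp
      exact step S T a p b hE h (ih (by omega) (h.erase_ear hE) (by omega))

theorem card_add_three (h : IsTriangulationOf S T) (hS : 2 ≤ S.card) :
    T.card + 3 = 2 * S.card := by
  refine ear_induction (motive := fun S T => T.card + 3 = 2 * S.card) ?_ ?_ hS h
  · intro a b hab
    rw [Finset.card_pair hab.ne, Finset.card_singleton]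
  · intro S T a p b hE h ih
    have hp : p ∈ S := (h.mem _ hE.left_mem).2
    have hne : Edge.mk hE.mid_lt ≠ Edge.mk hE.lt_mid := fun heq => by
      simp only [Edge.mk, Subtype.mk.injEq, Prod.mk.injEq] at heq
      exact hE.lt_mid.ne' heq.1
    have h3 := Finset.card_erase_add_one (Finset.mem_erase.2 ⟨hne, hE.right_mem⟩)
    have h1 := Finset.card_erase_add_one hE.left_mem
    have h2 := Finset.card_erase_add_one hp
    omega

/-! ### Tropical Ptolemy relations and ears. -/

theorem _root_.PfaffianFan.IsEar.cyclic {a p b c : Fin n}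
    (hE : IsEar S T a p b) (hc : c ∈ S) (hca : c ≠ a) (hcp : c ≠ p) (hcb : c ≠ b) :
    Cyclic a p b c := by
  have := hE.eq_mid c hc
  have h1 := hE.lt_mid
  have h2 := hE.mid_lt
  unfold Cyclic
  omega

/-- A solution of the tropical Ptolemy relations is determined by its values on a triangulation. -/
theorem ptolemy_unique (h : IsTriangulationOf S T) (hS : 2 ≤ S.card)
    {d d' : Fin n → Fin n → ℝ} (hd : ∀ i j, d i j = d j i) (hd' : ∀ i j, d' i j = d' j i)
    (hP : IsPtolemy S d) (hP' : IsPtolemy S d')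
    (hT : ∀ e ∈ T, d e.1.1 e.1.2 = d' e.1.1 e.1.2) :
    ∀ i ∈ S, ∀ j ∈ S, i ≠ j → d i j = d' i j := by
  revert hP hP' hT
  refine ear_induction (motive := fun S T => IsPtolemy S d → IsPtolemy S d' →
    (∀ e ∈ T, d e.1.1 e.1.2 = d' e.1.1 e.1.2) →
      ∀ i ∈ S, ∀ j ∈ S, i ≠ j → d i j = d' i j) ?_ ?_ hS h
  · intro a b hab _ _ hT i hi j hj hij
    have := hT _ (Finset.mem_singleton_self _)
    dsimp only at this
    simp only [Finset.mem_insert, Finset.mem_singleton] at hi hj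
    rcases hi with rfl | rfl <;> rcases hj with rfl | rfl
    · exact absurd rfl hij
    · exact this
    · rw [hd, hd', this]
    · exact absurd rfl hij
  · intro S T a p b hE h ih hP hP' hT
    have hpS : p ∈ S := (h.mem _ hE.left_mem).2
    have haS : a ∈ S := (h.mem _ hE.left_mem).1
    have hbS : b ∈ S := (h.mem _ hE.right_mem).2
    have sub : ∀ {d}, IsPtolemy S d → IsPtolemy (S.erase p) d := fun hQ i hi j hj k hk l hl =>
      hQ i (Finset.mem_of_mem_erase hi) j (Finset.mem_of_mem_erase hj)
        k (Finset.mem_of_mem_erase hk) l (Finset.mem_of_mem_erase hl)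
    have IH := ih (sub hP) (sub hP') fun e he =>
      hT e (Finset.mem_of_mem_erase (Finset.mem_of_mem_erase he))
    have hap := hT _ hE.left_mem
    have hpb := hT _ hE.right_mem
    have hab := hT _ hE.base_mem
    dsimp only at hap hpb hab
    have key : ∀ c ∈ S, c ≠ p → d p c = d' p c := by
      intro c hc hcp
      by_cases hca : c = a
      · rw [hca, hd, hd', hap]
      by_cases hcb : c = b
      · rw [hcb, hpb]
      -- In the quadrangle `a, p, b, c` the entry at `{p, c}` occurs only on the left of the
      -- relation, which thus expresses it by known values.
      have hcyc := hE.cyclic hc hca hcp hcb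
      have e1 := hP.cyclic hd haS hpS hbS hc hcyc
      have e2 := hP'.cyclic hd' haS hpS hbS hc hcyc
      have mem : ∀ {x}, x ∈ S → x ≠ p → x ∈ S.erase p := fun hx hne =>
        Finset.mem_erase.2 ⟨hne, hx⟩
      have f1 := IH b (mem hbS hE.mid_lt.ne') c (mem hc hcp) (Ne.symm hcb)
      have f2 := IH a (mem haS hE.lt_mid.ne) c (mem hc hcp) (Ne.symm hca)
      unfold Ptolemy at e1 e2
      rw [hap, hpb, hab, f1, f2] at e1
      linarith
    intro i hi j hj hij
    by_cases hip : i = p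
    · rw [hip]
      exact key j hj (by rw [← hip]; exact hij.symm)
    by_cases hjp : j = p
    · rw [hjp, hd, hd']
      exact key i hi hip
    exact IH i (Finset.mem_erase.2 ⟨hip, hi⟩) j (Finset.mem_erase.2 ⟨hjp, hj⟩) hij

/-- Gluing an ear with base `{a, b}` to a solution of the tropical Ptolemy relations. -/
theorem ptolemy_extend (h : IsTriangulationOf S T) {a p b : Fin n} (hE : IsEar S T a p b)
    {d : Fin n → Fin n → ℝ} (hd : ∀ i j, d i j = d j i) (hP : IsPtolemy (S.erase p) d)
    (hpa : ∀ c ∈ S, c ≠ a → c ≠ p → c ≠ b →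
      d p c = max (d a p + d b c) (d p b + d a c) - d a b) : IsPtolemy S d := by
  have hpS : p ∈ S := (h.mem _ hE.left_mem).2
  have haS : a ∈ S := (h.mem _ hE.left_mem).1
  have hbS : b ∈ S := (h.mem _ hE.right_mem).2
  have h1 := hE.lt_mid
  have h2 := hE.mid_lt
  have haS' : a ∈ S.erase p := Finset.mem_erase.2 ⟨h1.ne, haS⟩
  have hbS' : b ∈ S.erase p := Finset.mem_erase.2 ⟨h2.ne', hbS⟩
  refine isPtolemy_of_forall_mem (p := p) hd hP fun u hu v hv w hw hc => ?_
  obtain ⟨pu, uS⟩ := Finset.mem_erase.1 hu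
  obtain ⟨pv, vS⟩ := Finset.mem_erase.1 hv
  obtain ⟨pw, wS⟩ := Finset.mem_erase.1 hw
  have eu := hE.eq_mid u uS
  have ev := hE.eq_mid v vS
  have ew := hE.eq_mid w wS
  have hua : u ≠ a := by unfold Cyclic at hc; omega
  have hva : v ≠ a := by unfold Cyclic at hc; omega
  have hvb : v ≠ b := by unfold Cyclic at hc; omega
  have hwb : w ≠ b := by unfold Cyclic at hc; omega
  have rv := hpa v vS hva pv hvb
  have Pb : u ≠ b → Ptolemy d b u v w := fun hub =>
    hP.cyclic hd hbS' hu hv hw (by unfold Cyclic at hc ⊢; omega)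
  have Pa : w ≠ a → Ptolemy d a u v w := fun hwa =>
    hP.cyclic hd haS' hu hv hw (by unfold Cyclic at hc ⊢; omega)
  have s1 := hd a p
  have s2 := hd a b
  have s3 := hd u v
  have s4 := hd v w
  have s5 := hd u w
  -- By `hpa` the row of `p` is a tropical linear combination of the rows of `a` and `b`, so its
  -- relation follows from those for `a, u, v, w` and `b, u, v, w`. If `u = b` the one for `a`
  -- suffices, if `w = a` the one for `b`; if both hold, the claim is the formula for `d p v`.
  unfold Ptolemy at Pa Pb ⊢
  by_cases hub : u = b
  · subst hub
    by_cases hwa : w = a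
    · subst hwa
      rw [rv, ← s1, ← s2, ← s4, max_comm, add_comm (d w p)]
      ring
    · have Pa := Pa hwa
      have rw' := hpa w wS hwa pw hwb
      rw [rv, rw']
      grind
  · have Pb := Pb hub
    have ru := hpa u uS hua pu hub
    by_cases hwa : w = a
    · subst hwa
      rw [rv, ru]
      grind
    · have Pa := Pa hwa
      have rw' := hpa w wS hwa pw hwb
      rw [rv, ru, rw']
      grind

/-- The values on a triangulation of a solution of the tropical Ptolemy relations are arbitrary. -/
theorem exists_ptolemy (h : IsTriangulationOf S T) (hS : 2 ≤ S.card) (x : Edge n → ℝ) :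
    ∃ d : Fin n → Fin n → ℝ, (∀ i j, d i j = d j i) ∧ IsPtolemy S d ∧
      ∀ e ∈ T, d e.1.1 e.1.2 = x e := by
  refine ear_induction (motive := fun S T => ∃ d : Fin n → Fin n → ℝ, (∀ i j, d i j = d j i) ∧
    IsPtolemy S d ∧ ∀ e ∈ T, d e.1.1 e.1.2 = x e) ?_ ?_ hS h
  · intro a b hab
    refine ⟨fun _ _ => x (Edge.mk hab), fun _ _ => rfl, fun i _ j _ k _ l _ _ _ _ => ?_, ?_⟩
    · simp [Ptolemy]
    · intro e he
      rw [Finset.mem_singleton.1 he]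
  · rintro S T a p b hE h ⟨d, hd, hP, hT⟩
    have h1 := hE.lt_mid
    have h2 := hE.mid_lt
    -- The row of the new vertex `p`: prescribed at `a` and `b`, elsewhere forced by the relation in
    -- `a, p, b, c`.
    let r : Fin n → ℝ := fun c =>
      if c = a then x (Edge.mk h1) else if c = b then x (Edge.mk h2) else
        max (x (Edge.mk h1) + d b c) (x (Edge.mk h2) + d a c) - d a b
    let D : Fin n → Fin n → ℝ := fun i j => if i = p then r j else if j = p then r i else d i j
    have D0 : ∀ i j, i ≠ p → j ≠ p → D i j = d i j := fun i j hi hj => by simp [D, hi, hj]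
    have D1 : ∀ j, D p j = r j := fun j => by simp [D]
    have D2 : ∀ i, D i p = r i := fun i => by
      by_cases hi : i = p
      · rw [hi, D1]
      · simp [D, hi]
    have hD : ∀ i j, D i j = D j i := fun i j => by
      by_cases hi : i = p
      · rw [hi, D1, D2]
      by_cases hj : j = p
      · rw [hj, D1, D2]
      rw [D0 i j hi hj, D0 j i hj hi, hd]
    have ra : r a = x (Edge.mk h1) := by simp [r]
    have rb : r b = x (Edge.mk h2) := by simp [r, (h1.trans h2).ne']
    refine ⟨D, hD, ptolemy_extend h hE hD ?_ ?_, ?_⟩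
    · intro i hi j hj k hk l hl hij hjk hkl
      have ne : ∀ {x}, x ∈ S.erase p → x ≠ p := Finset.ne_of_mem_erase
      unfold Ptolemy
      rw [D0 i k (ne hi) (ne hk), D0 j l (ne hj) (ne hl), D0 i j (ne hi) (ne hj),
        D0 k l (ne hk) (ne hl), D0 i l (ne hi) (ne hl), D0 j k (ne hj) (ne hk)]
      exact hP i hi j hj k hk l hl hij hjk hkl
    · intro c _ hca hcp hcb
      rw [D1, D1, D2, ra, rb, D0 b c h2.ne' hcp, D0 a c h1.ne hcp, D0 a b h1.ne h2.ne']
      simp [r, hca, hcb]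
    · intro e he
      by_cases e1 : e = Edge.mk h1
      · subst e1
        rw [D2, ra]
      by_cases e2 : e = Edge.mk h2
      · subst e2
        rw [D1, rb]
      have he' : e ∈ (T.erase (Edge.mk h1)).erase (Edge.mk h2) :=
        Finset.mem_erase.2 ⟨e2, Finset.mem_erase.2 ⟨e1, he⟩⟩
      have hm := (h.erase_ear hE).mem e he'
      rw [D0 _ _ (Finset.ne_of_mem_erase hm.1) (Finset.ne_of_mem_erase hm.2), hT e he']

end IsTriangulationOf

variable {n : ℕ}

/-! ### Triangulations of the polygon -/

theorem Crosses.symm {e f : Edge n} (h : Crosses e f) : Crosses f e := Or.symm h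

theorem not_crosses_self (e : Edge n) : ¬ Crosses e e := by
  unfold Crosses
  omega

theorem isFree_two_iff {S : Finset (Edge n)} :
    IsFree 2 S ↔ ∀ e ∈ S, ∀ f ∈ S, ¬ Crosses e f := by
  constructor
  · intro h e he f hf hc
    have hne : e ≠ f := fun heq => not_crosses_self f (heq ▸ hc)
    refine h {e, f} (by simp [Finset.insert_subset_iff, he, hf]) ?_ (Finset.card_pair hne)
    unfold MutuallyCrossing
    rw [Finset.coe_pair, Set.pairwise_pair]
    exact fun _ => ⟨hc, hc.symm⟩
  · intro h R hR hm hcard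
    obtain ⟨e, f, hne, rfl⟩ := Finset.card_eq_two.1 hcard
    exact h e (hR (by simp)) f (hR (by simp)) (hm (by simp) (by simp) hne)

theorem IsTriangulation.isTriangulationOf_univ {T : Finset (Edge n)} (hT : IsTriangulation 1 T) :
    IsTriangulationOf Finset.univ T where
  mem _ _ := ⟨Finset.mem_univ _, Finset.mem_univ _⟩
  not_crosses := isFree_two_iff.1 hT.1
  maximal := by
    classical
    intro e _ _ he
    have hfree : IsFree (1 + 1) (insert e T) := by
      refine isFree_two_iff.2 fun f hf g hg hc => ?_
      rcases Finset.mem_insert.1 hf with rfl | hf' <;> rcases Finset.mem_insert.1 hg with rfl | hg'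
      · exact not_crosses_self _ hc
      · exact he g hg' hc
      · exact he f hf' hc.symm
      · exact isFree_two_iff.1 hT.1 f hf' g hg' hc
    exact hT.2 hfree (Finset.subset_insert e T) (Finset.mem_insert_self e T)

theorem not_crosses_of_not_isRelevant {e : Edge n} (he : ¬ IsRelevant 1 e) (f : Edge n) :
    ¬ Crosses e f := by
  obtain ⟨⟨a, b⟩, hab⟩ := e
  obtain ⟨⟨c, d⟩, hcd⟩ := f
  unfold Crosses
  unfold IsRelevant at he
  dsimp only at *
  omega

theorem card_not_isRelevant (hn : 3 ≤ n) :
    (Finset.univ.filter fun e : Edge n => ¬ IsRelevant 1 e).card = n := by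
  -- The last vertex receives the wrap-around side `{0, n - 1}`. It differs from `{0, 1}` because `n
  -- ≥ 3`.
  let side : Fin n → Edge n := fun i =>
    if h : (i : ℕ) + 1 < n then Edge.mk (i := i) (j := ⟨i + 1, h⟩) (by simp [Fin.lt_def])
    else Edge.mk (i := ⟨0, by omega⟩) (j := i) (by simp only [Fin.lt_def]; omega)
  have hside : (Finset.univ.filter fun e : Edge n => ¬ IsRelevant 1 e) =
      Finset.univ.image side := by
    ext e
    obtain ⟨⟨a, b⟩, hab⟩ := e
    simp only [Finset.mem_filter, Finset.mem_univ, true_and, Finset.mem_image]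
    constructor
    · intro h
      unfold IsRelevant at h
      dsimp only at h hab
      by_cases hb : (b : ℕ) = a + 1
      · refine ⟨a, ?_⟩
        have : (a : ℕ) + 1 < n := by omega
        simp only [side, this, dif_pos, Edge.mk, Subtype.mk.injEq, Prod.mk.injEq, true_and]
        exact Fin.ext hb.symm
      · refine ⟨b, ?_⟩
        have : ¬ (b : ℕ) + 1 < n := by omega
        simp only [side, this, dif_neg, not_false_iff, Edge.mk, Subtype.mk.injEq, Prod.mk.injEq,
          and_true]
        exact Fin.ext (by dsimp only; omega)
    · rintro ⟨i, hi⟩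
      rw [← hi]
      unfold IsRelevant
      by_cases h : (i : ℕ) + 1 < n
      · simp only [side, h, dif_pos]
        omega
      · simp only [side, h, dif_neg, not_false_iff]
        omega
  rw [hside, Finset.card_image_of_injective, Finset.card_univ, Fintype.card_fin]
  intro i j hij
  by_cases h : (i : ℕ) + 1 < n <;> by_cases h' : (j : ℕ) + 1 < n <;>
    simp only [side, h, h', dif_pos, dif_neg, not_false_iff, Edge.mk, Subtype.mk.injEq,
      Prod.mk.injEq, Fin.ext_iff] at hij <;> exact Fin.ext (by omega)

theorem IsTriangulation.mem_of_not_isRelevant {T : Finset (Edge n)} (hT : IsTriangulation 1 T)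
    {e : Edge n} (he : ¬ IsRelevant 1 e) : e ∈ T :=
  hT.isTriangulationOf_univ.maximal e (Finset.mem_univ _) (Finset.mem_univ _) fun f _ =>
    not_crosses_of_not_isRelevant he f

theorem IsTriangulation.card_add_three {T : Finset (Edge n)} (hT : IsTriangulation 1 T)
    (hn : 3 ≤ n) : T.card + 3 = 2 * n := by
  have := hT.isTriangulationOf_univ.card_add_three
    (by rw [Finset.card_univ, Fintype.card_fin]; omega)
  rwa [Finset.card_univ, Fintype.card_fin] at this

theorem IsTriangulation.card_relevantPart {T : Finset (Edge n)} (hT : IsTriangulation 1 T)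
    (hn : 3 ≤ n) : (relevantPart 1 T).card + 3 = n := by
  have h1 := Finset.card_filter_add_card_filter_not (s := T) (IsRelevant (n := n) 1)
  have h2 : (T.filter fun e => ¬ IsRelevant 1 e) =
      Finset.univ.filter fun e : Edge n => ¬ IsRelevant 1 e := by
    ext e
    simp only [Finset.mem_filter, Finset.mem_univ, true_and, and_iff_right_iff_imp]
    exact hT.mem_of_not_isRelevant
  rw [h2, card_not_isRelevant hn] at h1
  have h3 := hT.card_add_three hn
  have : (relevantPart 1 T).card = (T.filter (IsRelevant 1)).card := rfl
  omega

/-! ### Perfect matchings of four vertices -/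

theorem exists_lt_of_card_eq_four {U : Finset (Fin n)} (hU : U.card = 4) :
    ∃ i j k l, i < j ∧ j < k ∧ k < l ∧ U = {i, j, k, l} := by
  let f := U.orderEmbOfFin hU
  refine ⟨f 0, f 1, f 2, f 3, f.strictMono (by decide), f.strictMono (by decide),
    f.strictMono (by decide), ?_⟩
  have h := Finset.image_orderEmbOfFin_univ U hU
  rw [← h]
  ext x
  simp only [Finset.mem_image, Finset.mem_univ, true_and, Finset.mem_insert, Finset.mem_singleton,
    Fin.exists_iff]
  constructor
  · rintro ⟨m, hm, rfl⟩
    interval_cases m <;> simp [f]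
  · rintro (rfl | rfl | rfl | rfl)
    exacts [⟨0, by omega, rfl⟩, ⟨1, by omega, rfl⟩, ⟨2, by omega, rfl⟩, ⟨3, by omega, rfl⟩]

theorem card_four {i j k l : Fin n} (hij : i < j) (hjk : j < k) (hkl : k < l) :
    ({i, j, k, l} : Finset (Fin n)).card = 4 := by
  rw [Finset.card_insert_of_notMem, Finset.card_insert_of_notMem, Finset.card_pair hkl.ne]
  · simp only [Finset.mem_insert, Finset.mem_singleton]
    omega
  · simp only [Finset.mem_insert, Finset.mem_singleton]
    omega

theorem isMatching_pair {e f : Edge n}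
    (h : e.1.1 ≠ f.1.1 ∧ e.1.1 ≠ f.1.2 ∧ e.1.2 ≠ f.1.1 ∧ e.1.2 ≠ f.1.2) {U : Finset (Fin n)}
    (hU : ∀ x, x ∈ U ↔ x = e.1.1 ∨ x = e.1.2 ∨ x = f.1.1 ∨ x = f.1.2) :
    IsMatching U {e, f} := by
  obtain ⟨h1, h2, h3, h4⟩ := h
  refine ⟨?_, ?_⟩
  · intro g hg
    simp only [Finset.mem_insert, Finset.mem_singleton] at hg
    rcases hg with rfl | rfl <;> simp [hU]
  · intro u hu
    have he : u = e.1.1 ∨ u = e.1.2 ∨ u = f.1.1 ∨ u = f.1.2 := (hU u).1 hu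
    simp only [Finset.mem_insert, Finset.mem_singleton, Edge.HasEnd]
    by_cases hue : u = e.1.1 ∨ u = e.1.2
    · refine ⟨e, ⟨Or.inl rfl, hue⟩, ?_⟩
      rintro g ⟨rfl | rfl, hg⟩
      · rfl
      · rcases hue with rfl | rfl <;> tauto
    · refine ⟨f, ⟨Or.inr rfl, by tauto⟩, ?_⟩
      rintro g ⟨rfl | rfl, hg⟩
      · exact absurd hg hue
      · rfl

theorem isMatching_four_iff {i j k l : Fin n} (hij : i < j) (hjk : j < k) (hkl : k < l)
    {M : Finset (Edge n)} :
    IsMatching {i, j, k, l} M ↔ M = {Edge.mk hij, Edge.mk hkl} ∨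
      M = {Edge.mk (hij.trans hjk), Edge.mk (hjk.trans hkl)} ∨
      M = {Edge.mk ((hij.trans hjk).trans hkl), Edge.mk hjk} := by
  constructor
  · rintro ⟨hM, hU⟩
    have hdis : ∀ e ∈ M, ∀ f ∈ M, (f = e) ∨
        (f.1.1 ≠ e.1.1 ∧ f.1.1 ≠ e.1.2 ∧ f.1.2 ≠ e.1.1 ∧ f.1.2 ≠ e.1.2) := by
      intro e he f hf
      by_cases heq : f = e
      · exact Or.inl heq
      · have hne : ∀ u, e.HasEnd u → ¬ f.HasEnd u := fun u h1 h2 =>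
          heq ((hU u (by rcases h1 with rfl | rfl; exacts [(hM e he).1, (hM e he).2])).unique
            ⟨hf, h2⟩ ⟨he, h1⟩)
        have h1 := hne _ (Or.inl rfl)
        have h2 := hne _ (Or.inr rfl)
        unfold Edge.HasEnd at h1 h2
        exact Or.inr (by tauto)
    have main : ∀ e f : Edge n, e ∈ M → f ∈ M →
        (∀ u, u ∈ ({i, j, k, l} : Finset (Fin n)) → e.HasEnd u ∨ f.HasEnd u) → M = {e, f} := by
      intro e f he hf hcov
      ext g
      simp only [Finset.mem_insert, Finset.mem_singleton]
      constructor
      · intro hg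
        have hgU := (hM g hg).1
        rcases hcov _ hgU with h | h
        · exact Or.inl ((hU _ hgU).unique ⟨hg, Or.inl rfl⟩ ⟨he, h⟩)
        · exact Or.inr ((hU _ hgU).unique ⟨hg, Or.inl rfl⟩ ⟨hf, h⟩)
      · rintro (rfl | rfl) <;> assumption
    have pick : ∀ u, u ∈ ({i, j, k, l} : Finset (Fin n)) → ∃ a b, ∃ h : a < b,
        Edge.mk h ∈ M ∧ (u = a ∨ u = b) ∧ (a = i ∨ a = j ∨ a = k ∨ a = l) ∧
          (b = i ∨ b = j ∨ b = k ∨ b = l) := by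
      intro u hu
      obtain ⟨⟨⟨a, b⟩, hab⟩, ⟨he, hend⟩, -⟩ := hU u hu
      have := hM _ he
      simp only [Finset.mem_insert, Finset.mem_singleton] at this
      exact ⟨a, b, hab, he, hend, this⟩
    have cov : ∀ {a b c d : Fin n} (h1 : a < b) (h2 : c < d),
        (∀ u, (u = i ∨ u = j ∨ u = k ∨ u = l) → (u = a ∨ u = b) ∨ (u = c ∨ u = d)) →
        ∀ u, u ∈ ({i, j, k, l} : Finset (Fin n)) →
          (Edge.mk h1).HasEnd u ∨ (Edge.mk h2).HasEnd u := fun h1 h2 h u hu =>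
      h u (by simpa only [Finset.mem_insert, Finset.mem_singleton] using hu)
    -- The partner of the smallest vertex `i` decides the matching.
    obtain ⟨a, b, hab, he, hi, ha', hb'⟩ := pick i (by simp)
    have ha : a = i := by omega
    subst ha
    have hb : b = j ∨ b = k ∨ b = l := by omega
    rcases hb with rfl | rfl | rfl
    · obtain ⟨c, d, hcd, hf, hk, hc', hd'⟩ := pick k (by simp)
      have h := hdis _ he _ hf
      simp only [Edge.mk, Subtype.mk.injEq, Prod.mk.injEq] at h
      obtain rfl : c = k := by omega
      obtain rfl : d = l := by omega
      exact Or.inl (main _ _ he hf (cov _ _ (by rintro u (rfl | rfl | rfl | rfl) <;> simp)))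
    · obtain ⟨c, d, hcd, hf, hk, hc', hd'⟩ := pick j (by simp)
      have h := hdis _ he _ hf
      simp only [Edge.mk, Subtype.mk.injEq, Prod.mk.injEq] at h
      obtain rfl : c = j := by omega
      obtain rfl : d = l := by omega
      exact Or.inr (Or.inl (main _ _ he hf
        (cov _ _ (by rintro u (rfl | rfl | rfl | rfl) <;> simp))))
    · obtain ⟨c, d, hcd, hf, hk, hc', hd'⟩ := pick j (by simp)
      have h := hdis _ he _ hf
      simp only [Edge.mk, Subtype.mk.injEq, Prod.mk.injEq] at h
      obtain rfl : c = j := by omega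
      obtain rfl : d = k := by omega
      exact Or.inr (Or.inr (main _ _ he hf
        (cov _ _ (by rintro u (rfl | rfl | rfl | rfl) <;> simp))))
  · rintro (rfl | rfl | rfl)
    · exact isMatching_pair (by dsimp only; omega) (by intro x; simp)
    · exact isMatching_pair (by dsimp only; omega) (by intro x; simp; tauto)
    · exact isMatching_pair (by dsimp only; omega) (by intro x; simp; tauto)

/-! ### The prevariety in terms of tropical Ptolemy relations -/

/-- The symmetric function with the entries of `v`, and with zero diagonal. -/
noncomputable def symm (v : Edge n → ℝ) (i j : Fin n) : ℝ :=
  if h : i < j then v (Edge.mk h) else if h : j < i then v (Edge.mk h) else 0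

theorem symm_of_lt (v : Edge n → ℝ) {i j : Fin n} (h : i < j) : symm v i j = v (Edge.mk h) :=
  dif_pos h

theorem symm_self (v : Edge n → ℝ) (i : Fin n) : symm v i i = 0 := by simp [symm]

theorem symm_comm (v : Edge n → ℝ) (i j : Fin n) : symm v i j = symm v j i := by
  rcases lt_trichotomy i j with h | rfl | h
  · simp [symm, h, h.not_gt]
  · rfl
  · simp [symm, h, h.not_gt]

theorem weight_pair (v : Edge n → ℝ) {i j k l : Fin n} (h1 : i < j) (h2 : k < l)
    (h : ¬ (i = k ∧ j = l)) :
    weight v {Edge.mk h1, Edge.mk h2} = symm v i j + symm v k l := by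
  rw [symm_of_lt v h1, symm_of_lt v h2]
  exact Finset.sum_pair (by simpa [Edge.mk] using h)

theorem mem_grobnerCone_iff {v : Edge n → ℝ} : v ∈ grobnerCone 1 n ↔
    ∀ i j k l : Fin n, i < j → j < k → k < l →
      symm v i j + symm v k l ≤ symm v i k + symm v j l ∧
        symm v i l + symm v j k ≤ symm v i k + symm v j l := by
  constructor
  · intro h i j k l hij hjk hkl
    have hc : ({i, j, k, l} : Finset (Fin n)).card = 2 * 1 + 2 := card_four hij hjk hkl
    have h0 := h _ hc {Edge.mk (hij.trans hjk), Edge.mk (hjk.trans hkl)}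
      ((isMatching_four_iff hij hjk hkl).2 (Or.inr (Or.inl rfl))) (by
        unfold MutuallyCrossing
        rw [Finset.coe_pair, Set.pairwise_pair]
        intro _
        simp only [Crosses]
        omega)
    rw [weight_pair _ _ _ (by omega)] at h0
    have h1 := h0 _ ((isMatching_four_iff hij hjk hkl).2 (Or.inl rfl))
    have h2 := h0 _ ((isMatching_four_iff hij hjk hkl).2 (Or.inr (Or.inr rfl)))
    rw [weight_pair _ _ _ (by omega)] at h1 h2
    exact ⟨h1, h2⟩
  · intro h U hU M₀ hM₀ hcr M hM
    obtain ⟨i, j, k, l, hij, hjk, hkl, rfl⟩ := exists_lt_of_card_eq_four hU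
    obtain ⟨h1, h2⟩ := h i j k l hij hjk hkl
    have h0 : M₀ = {Edge.mk (hij.trans hjk), Edge.mk (hjk.trans hkl)} := by
      rcases (isMatching_four_iff hij hjk hkl).1 hM₀ with rfl | h | rfl
      · exfalso
        unfold MutuallyCrossing at hcr
        rw [Finset.coe_pair, Set.pairwise_pair] at hcr
        have := hcr (by simp only [Edge.mk, ne_eq, Subtype.mk.injEq, Prod.mk.injEq]; omega)
        simp only [Crosses] at this
        omega
      · exact h
      · exfalso
        unfold MutuallyCrossing at hcr
        rw [Finset.coe_pair, Set.pairwise_pair] at hcr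
        have := hcr (by simp only [Edge.mk, ne_eq, Subtype.mk.injEq, Prod.mk.injEq]; omega)
        simp only [Crosses] at this
        omega
    rw [h0, weight_pair _ _ _ (by omega)]
    rcases (isMatching_four_iff hij hjk hkl).1 hM with rfl | rfl | rfl <;>
      rw [weight_pair _ _ _ (by omega)]
    · exact h1
    · exact h2

/-- In the Gröbner cone the crossing matching is maximal among the three, so the maximum is attained
twice exactly when it equals the larger of the other two. -/
theorem mem_tropPfaffianPlus_iff {v : Edge n → ℝ} :
    v ∈ tropPfaffianPlus 1 n ↔ IsPtolemy Finset.univ (symm v) := by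
  constructor
  · rintro ⟨h, hG⟩ i - j - k - l - hij hjk hkl
    obtain ⟨g1, g2⟩ := mem_grobnerCone_iff.1 hG i j k l hij hjk hkl
    have hc : ({i, j, k, l} : Finset (Fin n)).card = 2 * 1 + 2 := card_four hij hjk hkl
    obtain ⟨M₁, M₂, hne, hM₁, hM₂, heq, hmax⟩ := h _ hc
    have hm := hmax _ ((isMatching_four_iff hij hjk hkl).2 (Or.inr (Or.inl rfl)))
    rw [weight_pair _ _ _ (by omega)] at hm
    unfold Ptolemy
    rcases (isMatching_four_iff hij hjk hkl).1 hM₁ with rfl | rfl | rfl <;>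
      rcases (isMatching_four_iff hij hjk hkl).1 hM₂ with rfl | rfl | rfl <;>
      first
      | exact absurd rfl hne
      | (rw [weight_pair _ _ _ (by omega)] at hm heq
         rw [weight_pair _ _ _ (by omega)] at heq
         grind)
  · intro h
    have hG : v ∈ grobnerCone 1 n := mem_grobnerCone_iff.2 fun i j k l hij hjk hkl => by
      have hP := h i (by simp) j (by simp) k (by simp) l (by simp) hij hjk hkl
      unfold Ptolemy at hP
      rw [hP]
      exact ⟨le_max_left _ _, le_max_right _ _⟩
    refine ⟨fun U hU => ?_, hG⟩
    obtain ⟨i, j, k, l, hij, hjk, hkl, rfl⟩ := exists_lt_of_card_eq_four hU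
    have hP := h i (by simp) j (by simp) k (by simp) l (by simp) hij hjk hkl
    obtain ⟨g1, g2⟩ := mem_grobnerCone_iff.1 hG i j k l hij hjk hkl
    unfold Ptolemy at hP
    have hmax : ∀ M, IsMatching {i, j, k, l} M →
        weight v M ≤ weight v {Edge.mk (hij.trans hjk), Edge.mk (hjk.trans hkl)} := by
      intro M hM
      rw [weight_pair _ _ _ (by omega)]
      rcases (isMatching_four_iff hij hjk hkl).1 hM with rfl | rfl | rfl <;>
        rw [weight_pair _ _ _ (by omega)]
      · exact g1
      · exact g2
    have h0 := (isMatching_four_iff hij hjk hkl).2 (Or.inr (Or.inl rfl))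
    rcases le_total (symm v i j + symm v k l) (symm v i l + symm v j k) with hle | hle
    · rw [max_eq_right hle] at hP
      refine ⟨_, _, ?_, h0, (isMatching_four_iff hij hjk hkl).2 (Or.inr (Or.inr rfl)), ?_, hmax⟩
      · intro he
        have : Edge.mk hjk ∈ ({Edge.mk (hij.trans hjk), Edge.mk (hjk.trans hkl)} :
          Finset (Edge n)) := he ▸ by simp
        simp only [Finset.mem_insert, Finset.mem_singleton, Edge.mk, Subtype.mk.injEq,
          Prod.mk.injEq] at this
        omega
      · rw [weight_pair _ _ _ (by omega), weight_pair _ _ _ (by omega), hP]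
    · rw [max_eq_left hle] at hP
      refine ⟨_, _, ?_, h0, (isMatching_four_iff hij hjk hkl).2 (Or.inl rfl), ?_, hmax⟩
      · intro he
        have : Edge.mk hij ∈ ({Edge.mk (hij.trans hjk), Edge.mk (hjk.trans hkl)} :
          Finset (Edge n)) := he ▸ by simp
        simp only [Finset.mem_insert, Finset.mem_singleton, Edge.mk, Subtype.mk.injEq,
          Prod.mk.injEq] at this
        omega
      · rw [weight_pair _ _ _ (by omega), weight_pair _ _ _ (by omega), hP]

/-! ### Separation vectors as coordinates -/

/-- The indicator function of the vertices `i` with `e.1.1 < i ≤ e.1.2`. -/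
noncomputable def arc (e : Edge n) (i : Fin n) : ℝ := if e.1.1 < i ∧ i ≤ e.1.2 then 1 else 0

/-- Exchanging the closed and open ends of the intervals moves the condition from the end-points of
`e` to those of `s`. The squared form reduces later identities to polynomial ones. -/
theorem ite_separates (e s : Edge n) [Decidable (Separates e s)] (c : ℝ) :
    (if Separates e s then c else 0) = c * (arc e s.1.1 - arc e s.1.2) ^ 2 := by
  obtain ⟨⟨a, b⟩, hab⟩ := e
  obtain ⟨⟨x, y⟩, hxy⟩ := s
  have key : Separates ⟨(a, b), hab⟩ ⟨(x, y), hxy⟩ ↔ ¬ ((a < x ∧ x ≤ b) ↔ (a < y ∧ y ≤ b)) := by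
    have hab' : a < b := hab
    have hxy' : x < y := hxy
    unfold Separates Xor
    dsimp only
    omega
  unfold arc
  dsimp only
  by_cases h1 : a < x ∧ x ≤ b <;> by_cases h2 : a < y ∧ y ≤ b
  · rw [if_pos h1, if_pos h2, if_neg (mt key.1 (by tauto))]
    ring
  · rw [if_pos h1, if_neg h2, if_pos (key.2 (by tauto))]
    ring
  · rw [if_neg h1, if_pos h2, if_pos (key.2 (by tauto))]
    ring
  · rw [if_neg h1, if_neg h2, if_neg (mt key.1 (by tauto))]
    ring

theorem separationVector_apply (w : Edge n → ℝ) (s : Edge n) :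
    separationVector w s = ∑ e, w e * (arc e s.1.1 - arc e s.1.2) ^ 2 :=
  Finset.sum_congr rfl fun e _ => by classical exact ite_separates e s (w e)

theorem symm_separationVector (w : Edge n → ℝ) (i j : Fin n) :
    symm (separationVector w) i j = ∑ e, w e * (arc e i - arc e j) ^ 2 := by
  rcases lt_trichotomy i j with h | rfl | h
  · rw [symm_of_lt _ h, separationVector_apply]
  · simp [symm_self]
  · rw [symm_comm, symm_of_lt _ h, separationVector_apply]
    exact Finset.sum_congr rfl fun e _ => by dsimp only; ring

/-- The separation vector as a linear map. -/
noncomputable def separationMap (n : ℕ) : (Edge n → ℝ) →ₗ[ℝ] (Edge n → ℝ) where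
  toFun := separationVector
  map_add' v w := by
    ext s
    simp only [separationVector_apply, Pi.add_apply, add_mul, Finset.sum_add_distrib]
  map_smul' c v := by
    ext s
    simp only [separationVector_apply, Pi.smul_apply, smul_eq_mul, RingHom.id_apply,
      Finset.mul_sum, mul_assoc]

theorem symm_add (v w : Edge n → ℝ) (i j : Fin n) : symm (v + w) i j = symm v i j + symm w i j := by
  unfold symm
  split_ifs <;> simp

theorem symm_smul (c : ℝ) (v : Edge n → ℝ) (i j : Fin n) : symm (c • v) i j = c * symm v i j := by
  unfold symm
  split_ifs <;> simp

/-- The isolation indices of the splits given by the edges of a polygon. -/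
noncomputable def isolationMap (n : ℕ) : (Edge n → ℝ) →ₗ[ℝ] (Edge n → ℝ) where
  toFun v e := (symm v e.1.1 e.1.2 + symm v (finRotate n e.1.1) (finRotate n e.1.2) -
    symm v e.1.1 (finRotate n e.1.2) - symm v (finRotate n e.1.1) e.1.2) / 2
  map_add' v w := by
    ext e
    simp only [symm_add, Pi.add_apply]
    ring
  map_smul' c v := by
    ext e
    simp only [symm_smul, Pi.smul_apply, smul_eq_mul, RingHom.id_apply]
    ring

theorem isolationMap_apply (v : Edge n → ℝ) (e : Edge n) : isolationMap n v e =
    (symm v e.1.1 e.1.2 + symm v (finRotate n e.1.1) (finRotate n e.1.2) -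
      symm v e.1.1 (finRotate n e.1.2) - symm v (finRotate n e.1.1) e.1.2) / 2 := rfl

theorem val_finRotate (i : Fin n) :
    (finRotate n i : ℕ) = if (i : ℕ) + 1 < n then (i : ℕ) + 1 else 0 := by
  obtain _ | m := n
  · exact i.elim0
  · by_cases h : i = Fin.last m
    · subst h
      simp
    · have : (i : ℕ) < m := Fin.val_lt_last h
      rw [coe_finRotate_of_ne_last h, if_pos (by omega)]

/-- The indicator of an interval jumps only at its two ends. The step from the last vertex to `0`
fits the formula because `arc e` always vanishes at `0`. -/
theorem arc_sub_arc_finRotate (e : Edge n) (i : Fin n) :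
    arc e i - arc e (finRotate n i) =
      (if i = e.1.2 then 1 else 0) - if i = e.1.1 then 1 else 0 := by
  obtain ⟨⟨a, b⟩, hab⟩ := e
  have hr := val_finRotate i
  unfold arc
  dsimp only at hab ⊢
  simp only [Fin.lt_def, Fin.le_def, Fin.ext_iff] at *
  rw [hr]
  have := i.2
  split_ifs <;> first | omega | norm_num

/-- On `(x i - x j) ^ 2` the mixed difference is minus the product of the jumps of `x` at the two
end-points of `f`. For `x = arc e` both jumps are nonzero only if `e = f`, and then they are `-1`
and `1`. The zero diagonal of `symm` is what makes this valid for sides as well. -/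
theorem isolationMap_separationVector (w : Edge n → ℝ) :
    isolationMap n (separationVector w) = w := by
  classical
  ext f
  rw [isolationMap_apply]
  simp only [symm_separationVector, ← Finset.sum_add_distrib, ← Finset.sum_sub_distrib]
  rw [Finset.sum_div, Finset.sum_eq_single f]
  · have h1 := arc_sub_arc_finRotate f f.1.1
    have h2 := arc_sub_arc_finRotate f f.1.2
    have hne : f.1.1 ≠ f.1.2 := f.2.ne
    rw [if_neg hne, if_pos rfl] at h1
    rw [if_pos rfl, if_neg hne.symm] at h2
    linear_combination (-w f) * h1 * (arc f f.1.2 - arc f (finRotate n f.1.2)) + w f * h2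
  · intro e _ hef
    have h1 := arc_sub_arc_finRotate e f.1.1
    have h2 := arc_sub_arc_finRotate e f.1.2
    have hz : (arc e f.1.1 - arc e (finRotate n f.1.1)) *
        (arc e f.1.2 - arc e (finRotate n f.1.2)) = 0 := by
      rw [h1, h2]
      obtain ⟨⟨a, b⟩, hab⟩ := e
      obtain ⟨⟨c, d⟩, hcd⟩ := f
      simp only [ne_eq, Subtype.mk.injEq, Prod.mk.injEq] at hef hab hcd ⊢
      split_ifs <;> first | omega | norm_num
    linear_combination (-w e) * hz
  · simp

/-- The coordinates of a weight vector with respect to the separation vectors of the edges. -/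
noncomputable def separationEquiv (n : ℕ) : (Edge n → ℝ) ≃ₗ[ℝ] (Edge n → ℝ) :=
  LinearEquiv.ofLinearMap (separationMap n) (isolationMap n)
    -- In finite dimension a one-sided inverse is two-sided.
    (mul_eq_one_comm.1 (LinearMap.ext isolationMap_separationVector))
    (LinearMap.ext isolationMap_separationVector)

/-- The edge `e` meets `{j, …, k - 1}` and the complement of `{i, …, l - 1}`. -/
def SplitsMiddle (e : Edge n) (i j k l : Fin n) : Prop :=
  (j ≤ e.1.1 ∧ e.1.1 < k ∧ l ≤ e.1.2) ∨ (e.1.1 < i ∧ j ≤ e.1.2 ∧ e.1.2 < k)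

/-- The edge `e` joins `{i, …, j - 1}` to `{k, …, l - 1}`. -/
def SplitsEnds (e : Edge n) (i j k l : Fin n) : Prop :=
  i ≤ e.1.1 ∧ e.1.1 < j ∧ k ≤ e.1.2 ∧ e.1.2 < l

open Classical in
theorem arc_mul_arc_middle (e : Edge n) {i j k l : Fin n} (hij : i < j) (hjk : j < k)
    (hkl : k < l) : (arc e i - arc e l) * (arc e j - arc e k) =
      if SplitsMiddle e i j k l then 1 else 0 := by
  obtain ⟨⟨a, b⟩, hab⟩ := e
  unfold arc SplitsMiddle
  dsimp only at *
  split_ifs <;> first | omega | norm_num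

open Classical in
theorem arc_mul_arc_ends (e : Edge n) {i j k l : Fin n} (hij : i < j) (hjk : j < k)
    (hkl : k < l) : (arc e j - arc e i) * (arc e k - arc e l) =
      if SplitsEnds e i j k l then 1 else 0 := by
  obtain ⟨⟨a, b⟩, hab⟩ := e
  unfold arc SplitsEnds
  dsimp only at *
  split_ifs <;> first | omega | norm_num

-- The squares cancel edge by edge and leave twice a product of two differences of `arc e`. For an
-- interval indicator and `i < j < k < l` this product is `0` or `1`, never negative; likewise in
-- `symm_sub_ends`.
open Classical in
theorem symm_sub_middle (w : Edge n → ℝ) {i j k l : Fin n} (hij : i < j) (hjk : j < k)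
    (hkl : k < l) :
    symm (separationVector w) i k + symm (separationVector w) j l =
      symm (separationVector w) i j + symm (separationVector w) k l +
        2 * ∑ e, if SplitsMiddle e i j k l then w e else 0 := by
  simp only [symm_separationVector, Finset.mul_sum, ← Finset.sum_add_distrib]
  refine Finset.sum_congr rfl fun e _ => ?_
  have h := arc_mul_arc_middle e hij hjk hkl
  rw [← mul_boole, ← h]
  ring

open Classical in
theorem symm_sub_ends (w : Edge n → ℝ) {i j k l : Fin n} (hij : i < j) (hjk : j < k)
    (hkl : k < l) :
    symm (separationVector w) i k + symm (separationVector w) j l =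
      symm (separationVector w) i l + symm (separationVector w) j k +
        2 * ∑ e, if SplitsEnds e i j k l then w e else 0 := by
  simp only [symm_separationVector, Finset.mul_sum, ← Finset.sum_add_distrib]
  refine Finset.sum_congr rfl fun e _ => ?_
  have h := arc_mul_arc_ends e hij hjk hkl
  rw [← mul_boole, ← h]
  ring

theorem SplitsMiddle.isRelevant {e : Edge n} {i j k l : Fin n} (hij : i < j) (hkl : k < l)
    (h : SplitsMiddle e i j k l) : IsRelevant 1 e := by
  unfold SplitsMiddle at h
  unfold IsRelevant
  omega

theorem SplitsEnds.isRelevant {e : Edge n} {i j k l : Fin n} (_ : j < k)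
    (h : SplitsEnds e i j k l) : IsRelevant 1 e := by
  unfold SplitsEnds at h
  unfold IsRelevant
  omega

theorem SplitsMiddle.crosses {e f : Edge n} {i j k l : Fin n}
    (he : SplitsMiddle e i j k l) (hf : SplitsEnds f i j k l) : Crosses e f := by
  unfold SplitsMiddle at he
  unfold SplitsEnds at hf
  unfold Crosses
  omega

/-! ### The Gröbner cone and the positive part in separation coordinates. -/

theorem separationVector_mem_grobnerCone_iff {w : Edge n → ℝ} :
    separationVector w ∈ grobnerCone 1 n ↔ ∀ e, IsRelevant 1 e → 0 ≤ w e := by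
  classical
  rw [mem_grobnerCone_iff]
  constructor
  · intro h e he
    -- The coefficient of a diagonal `{a, b}` is half the slack of an inequality for `a, a + 1, b, b
    -- + 1`. If `b` is the last vertex, `b + 1` is the vertex `0` and comes first, so the other
    -- inequality is used.
    rw [← isolationMap_separationVector w, isolationMap_apply]
    generalize separationVector w = v at h
    obtain ⟨⟨a, b⟩, hab⟩ := e
    have ha := val_finRotate a
    have hb := val_finRotate b
    unfold IsRelevant at he
    dsimp only at he hab ⊢
    rw [if_pos (by omega)] at ha
    by_cases hbn : (b : ℕ) + 1 < n
    · rw [if_pos hbn] at hb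
      have := (h a (finRotate n a) b (finRotate n b) (by omega) (by omega) (by omega)).2
      linarith
    · rw [if_neg hbn] at hb
      have := (h (finRotate n b) a (finRotate n a) b (by omega) (by omega) (by omega)).1
      rw [symm_comm v (finRotate n b) (finRotate n a), symm_comm v (finRotate n b) a] at this
      linarith
  · intro h i j k l hij hjk hkl
    rw [and_comm, symm_sub_ends w hij hjk hkl]
    refine ⟨?_, ?_⟩
    · have : 0 ≤ ∑ e, if SplitsEnds e i j k l then w e else 0 :=
        Finset.sum_nonneg fun e _ => by
          split_ifs with hs
          · exact h e (hs.isRelevant hjk)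
          · exact le_rfl
      linarith
    -- The earlier rewrite changed the crossing sum in both conjuncts; here it is undone.
    · rw [← symm_sub_ends w hij hjk hkl, symm_sub_middle w hij hjk hkl]
      have : 0 ≤ ∑ e, if SplitsMiddle e i j k l then w e else 0 :=
        Finset.sum_nonneg fun e _ => by
          split_ifs with hs
          · exact h e (hs.isRelevant hij hkl)
          · exact le_rfl
      linarith

theorem separationVector_mem_tropPfaffianPlus_iff {w : Edge n → ℝ} :
    separationVector w ∈ tropPfaffianPlus 1 n ↔ (∀ e, IsRelevant 1 e → 0 ≤ w e) ∧
      ∀ e f, Crosses e f → w e = 0 ∨ w f = 0 := by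
  classical
  constructor
  · intro hv
    have h := separationVector_mem_grobnerCone_iff.1 hv.2
    refine ⟨h, ?_⟩
    intro e f hc
    wlog hlt : e.1.1 < f.1.1 ∧ f.1.1 < e.1.2 ∧ e.1.2 < f.1.2 generalizing e f
    · exact (this f e hc.symm (by unfold Crosses at hc; tauto)).symm
    obtain ⟨h1, h2, h3⟩ := hlt
    have hP := mem_tropPfaffianPlus_iff.1 hv _ (Finset.mem_univ e.1.1) _ (Finset.mem_univ f.1.1)
      _ (Finset.mem_univ e.1.2) _ (Finset.mem_univ f.1.2) h1 h2 h3
    have hE := symm_sub_ends w h1 h2 h3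
    have hM := symm_sub_middle w h1 h2 h3
    -- In the quadrangle spanned by `e` and `f`, one defect counts `e` and the other counts `f`. The
    -- relation makes one of these sums of nonnegative terms vanish.
    have he : SplitsEnds e e.1.1 f.1.1 e.1.2 f.1.2 := ⟨le_rfl, h1, le_rfl, h3⟩
    have hf : SplitsMiddle f e.1.1 f.1.1 e.1.2 f.1.2 := Or.inl ⟨le_rfl, h2, le_rfl⟩
    have nE : ∀ g ∈ Finset.univ,
        0 ≤ if SplitsEnds g e.1.1 f.1.1 e.1.2 f.1.2 then w g else 0 := fun g _ => by
      split_ifs with hs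
      · exact h g (hs.isRelevant h2)
      · exact le_rfl
    have nM : ∀ g ∈ Finset.univ,
        0 ≤ if SplitsMiddle g e.1.1 f.1.1 e.1.2 f.1.2 then w g else 0 := fun g _ => by
      split_ifs with hs
      · exact h g (hs.isRelevant h1 h3)
      · exact le_rfl
    unfold Ptolemy at hP
    rcases max_choice
      (symm (separationVector w) e.1.1 f.1.1 + symm (separationVector w) e.1.2 f.1.2)
      (symm (separationVector w) e.1.1 f.1.2 + symm (separationVector w) f.1.1 e.1.2) with hm | hm
    · right
      have h0 : ∑ g, (if SplitsMiddle g e.1.1 f.1.1 e.1.2 f.1.2 then w g else 0) = 0 := by linarith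
      have := (Finset.sum_eq_zero_iff_of_nonneg nM).1 h0 f (Finset.mem_univ f)
      rwa [if_pos hf] at this
    · left
      have h0 : ∑ g, (if SplitsEnds g e.1.1 f.1.1 e.1.2 f.1.2 then w g else 0) = 0 := by linarith
      have := (Finset.sum_eq_zero_iff_of_nonneg nE).1 h0 e (Finset.mem_univ e)
      rwa [if_pos he] at this
  · rintro ⟨h, hc⟩
    refine mem_tropPfaffianPlus_iff.2 fun i _ j _ k _ l _ hij hjk hkl => ?_
    obtain ⟨g1, g2⟩ := mem_grobnerCone_iff.1 (separationVector_mem_grobnerCone_iff.2 h) i j k l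
      hij hjk hkl
    have hE := symm_sub_ends w hij hjk hkl
    have hM := symm_sub_middle w hij hjk hkl
    unfold Ptolemy
    -- A nonzero coefficient in one defect forces the other defect to vanish, since all its edges
    -- cross that edge.
    by_cases hex : ∃ e, SplitsEnds e i j k l ∧ w e ≠ 0
    · obtain ⟨e, he, hwe⟩ := hex
      have : ∑ g, (if SplitsMiddle g i j k l then w g else 0) = 0 :=
        Finset.sum_eq_zero fun g _ => by
          split_ifs with hs
          · exact (hc g e (hs.crosses he)).resolve_right hwe
          · rfl
      rw [this, mul_zero, add_zero] at hM
      rw [max_eq_left (by linarith), hM]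
    · push Not at hex
      have : ∑ g, (if SplitsEnds g i j k l then w g else 0) = 0 :=
        Finset.sum_eq_zero fun g _ => by
          split_ifs with hs
          · exact hex g hs
          · rfl
      rw [this, mul_zero, add_zero] at hE
      rw [max_eq_right (by linarith), hE]

/-! ### Fans from unique conic representations -/

section Fan

variable {ι V : Type*} [Fintype ι] [AddCommGroup V] [Module ℝ V]

/-- The functions on `ι` that are nonnegative and vanish outside of `D`. -/
def IsNonnegOn (D : Finset ι) (w : ι → ℝ) : Prop := (∀ e, 0 ≤ w e) ∧ ∀ e, e ∉ D → w e = 0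

theorem mem_hull_image_iff (g : ι → V) (D : Finset ι) (x : V) :
    x ∈ PointedCone.hull ℝ (g '' (D : Set ι)) ↔
      ∃ w : ι → ℝ, IsNonnegOn D w ∧ ∑ e, w e • g e = x := by
  classical
  constructor
  · intro hx
    induction hx using Submodule.span_induction with
    | mem x hx =>
      obtain ⟨e, he, rfl⟩ := hx
      refine ⟨Pi.single e 1, ⟨fun f => ?_, fun f hf => ?_⟩, ?_⟩
      · by_cases h : f = e
        · subst h
          simp
        · simp [h]
      · rw [Pi.single_eq_of_ne]
        rintro rfl
        exact hf he
      · rw [Finset.sum_eq_single e]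
        · simp
        · intro f _ hf
          simp [hf]
        · simp
    | zero => exact ⟨0, ⟨fun _ => le_rfl, fun _ _ => rfl⟩, by simp⟩
    | add x y _ _ hx hy =>
      obtain ⟨w, hw, rfl⟩ := hx
      obtain ⟨w', hw', rfl⟩ := hy
      refine ⟨w + w', ⟨fun e => add_nonneg (hw.1 e) (hw'.1 e), fun e he => ?_⟩, ?_⟩
      · simp [hw.2 e he, hw'.2 e he]
      · simp [add_smul, Finset.sum_add_distrib]
    | smul c x _ hx =>
      obtain ⟨w, hw, rfl⟩ := hx
      refine ⟨(c : ℝ) • w, ⟨fun e => mul_nonneg c.2 (hw.1 e), fun e he => ?_⟩, ?_⟩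
      · simp [hw.2 e he]
      · simp only [Pi.smul_apply, smul_assoc, ← Finset.smul_sum]
        rfl
  · rintro ⟨w, hw, rfl⟩
    refine Submodule.sum_mem _ fun e _ => ?_
    by_cases he : e ∈ D
    · exact PointedCone.smul_mem _ (hw.1 e) (PointedCone.subset_hull ⟨e, he, rfl⟩)
    · rw [hw.2 e he, zero_smul]
      exact Submodule.zero_mem _

/-- Conic combinations of the vectors `g e`, supported on members of `Δ`, determine their
coefficients. -/
def HasUniqueConicRep (g : ι → V) (Δ : Set (Finset ι)) : Prop :=
  ∀ D ∈ Δ, ∀ D' ∈ Δ, ∀ w w' : ι → ℝ, IsNonnegOn D w → IsNonnegOn D' w' →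
    ∑ e, w e • g e = ∑ e, w' e • g e → w = w'

variable {g : ι → V} {Δ : Set (Finset ι)}

/-- The positive and negative parts of a linear relation are two conic representations of one
vector, so they coincide; having disjoint supports, both are zero. -/
theorem HasUniqueConicRep.linearIndepOn (h : HasUniqueConicRep g Δ) {D : Finset ι} (hD : D ∈ Δ) :
    LinearIndepOn ℝ g (D : Set ι) := by
  classical
  rw [linearIndepOn_finset_iff]
  intro f hf e he
  have hsum : ∑ e, (if e ∈ D then max (f e) 0 else 0) • g e =
      ∑ e, (if e ∈ D then max (-f e) 0 else 0) • g e := by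
    rw [← sub_eq_zero, ← Finset.sum_sub_distrib, ← hf, ← Finset.sum_subset D.subset_univ]
    · refine Finset.sum_congr rfl fun e he => ?_
      rw [if_pos he, if_pos he, ← sub_smul]
      congr 1
      rcases le_total (f e) 0 with h0 | h0
      · rw [max_eq_right h0, max_eq_left (by linarith)]
        ring
      · rw [max_eq_left h0, max_eq_right (by linarith)]
        ring
    · intro e _ he
      simp [he]
  have := congrFun (h D hD D hD _ _ ⟨fun e => ?_, fun e he => if_neg he⟩
    ⟨fun e => ?_, fun e he => if_neg he⟩ hsum) e
  · rw [if_pos he, if_pos he] at this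
    rcases le_total (f e) 0 with h0 | h0
    · rw [max_eq_right h0, max_eq_left (by linarith)] at this
      linarith
    · rw [max_eq_left h0, max_eq_right (by linarith)] at this
      exact this
  · split_ifs
    · exact le_max_right _ _
    · exact le_rfl
  · split_ifs
    · exact le_max_right _ _
    · exact le_rfl

theorem isNonnegOn_single {κ : Type*} [DecidableEq κ] {D : Finset κ} {e : κ} (he : e ∈ D) :
    IsNonnegOn D (Pi.single e (1 : ℝ)) := by
  refine ⟨fun f => ?_, fun f hf => Pi.single_eq_of_ne (fun h : f = e => hf (by rw [h]; exact he)) _⟩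
  by_cases h : f = e
  · subst h
    simp
  · simp [h]

theorem HasUniqueConicRep.hull_le_hull_iff (h : HasUniqueConicRep g Δ) {D D' : Finset ι}
    (hD : D ∈ Δ) (hD' : D' ∈ Δ) :
    PointedCone.hull ℝ (g '' (D : Set ι)) ≤ PointedCone.hull ℝ (g '' (D' : Set ι)) ↔ D ⊆ D' := by
  classical
  refine ⟨fun hle e he => ?_, fun hs => Submodule.span_mono (Set.image_mono hs)⟩
  obtain ⟨w, hw, hsum⟩ := (mem_hull_image_iff g D' (g e)).1
    (hle (PointedCone.subset_hull ⟨e, he, rfl⟩))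
  have hw' := h D' hD' D hD w (Pi.single e 1) hw (isNonnegOn_single he) (by
    rw [hsum, Finset.sum_eq_single e] <;> simp +contextual)
  by_contra hne
  have := hw.2 e hne
  rw [hw', Pi.single_eq_same] at this
  exact one_ne_zero this

theorem IsNonnegOn.mono {κ : Type*} {D D' : Finset κ} {w : κ → ℝ}
    (hw : IsNonnegOn D w) (h : D ⊆ D') :
    IsNonnegOn D' w := ⟨hw.1, fun e he => hw.2 e fun h' => he (h h')⟩

theorem HasUniqueConicRep.hull_isFaceOf (h : HasUniqueConicRep g Δ) {D D' : Finset ι}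
    (hD : D ∈ Δ) (hs : D' ⊆ D) :
    (PointedCone.hull ℝ (g '' (D' : Set ι))).IsFaceOf (PointedCone.hull ℝ (g '' (D : Set ι))) where
  le := Submodule.span_mono (Set.image_mono hs)
  mem_of_smul_add_mem := by
    intro x y a hx hy ha hxy
    rw [mem_hull_image_iff] at *
    obtain ⟨w, hw, rfl⟩ := hx
    obtain ⟨w', hw', rfl⟩ := hy
    obtain ⟨u, hu, hsum⟩ := hxy
    have heq := h D hD D hD u (a • w + w') (hu.mono hs)
      ⟨fun e => add_nonneg (mul_nonneg ha.le (hw.1 e)) (hw'.1 e),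
        fun e he => by simp [hw.2 e he, hw'.2 e he]⟩ (by
        rw [hsum]
        simp only [Pi.add_apply, Pi.smul_apply, add_smul, smul_assoc, Finset.sum_add_distrib,
          Finset.smul_sum])
    refine ⟨w, ⟨hw.1, fun e he => ?_⟩, rfl⟩
    have h0 := hu.2 e he
    rw [heq, Pi.add_apply, Pi.smul_apply, smul_eq_mul] at h0
    have h1 := mul_nonneg ha.le (hw.1 e)
    have h2 := hw'.1 e
    exact (mul_eq_zero.1 (by linarith : a * w e = 0)).resolve_left ha.ne'

-- No uniqueness is needed: if a conic combination lies in a face, so does every vector with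
-- positive coefficient.
open Classical in
theorem eq_hull_of_isFaceOf {D : Finset ι} {F : PointedCone ℝ V}
    (hF : F.IsFaceOf (PointedCone.hull ℝ (g '' (D : Set ι)))) :
    F = PointedCone.hull ℝ (g '' ((D.filter fun e => g e ∈ F : Finset ι) : Set ι)) := by
  refine le_antisymm (fun x hx => ?_) (Submodule.span_le.2 ?_)
  · obtain ⟨w, hw, rfl⟩ := (mem_hull_image_iff g D x).1 (hF.le hx)
    -- Vectors outside `D` are replaced by `0`, because the face property needs all summands in the
    -- cone.
    have heq : ∑ e, w e • (if e ∈ D then g e else 0) = ∑ e, w e • g e :=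
      Finset.sum_congr rfl fun e _ => by
        by_cases he : e ∈ D
        · rw [if_pos he]
        · rw [hw.2 e he, zero_smul, zero_smul]
    rw [mem_hull_image_iff]
    refine ⟨w, ⟨hw.1, fun e he => ?_⟩, rfl⟩
    by_contra h0
    have hD : e ∈ D := by
      by_contra hD
      exact h0 (hw.2 e hD)
    have := hF.mem_of_sum_smul_mem (f := fun e => if e ∈ D then g e else 0) (fun f => by
        split_ifs with hf
        · exact PointedCone.subset_hull ⟨f, hf, rfl⟩
        · exact Submodule.zero_mem _) hw.1 (heq ▸ hx) e (lt_of_le_of_ne (hw.1 e) (Ne.symm h0))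
    rw [if_pos hD] at this
    exact he (Finset.mem_filter.2 ⟨hD, this⟩)
  · rintro _ ⟨e, he, rfl⟩
    exact (Finset.mem_filter.1 he).2

theorem HasUniqueConicRep.isCompleteSimplicialFan (h : HasUniqueConicRep g Δ)
    (hdown : ∀ D ∈ Δ, ∀ D' ⊆ D, D' ∈ Δ)
    (hcov : ∀ x, ∃ D ∈ Δ, x ∈ PointedCone.hull ℝ (g '' (D : Set ι))) :
    IsCompleteSimplicialFan ((fun D : Finset ι => PointedCone.hull ℝ (g '' (D : Set ι))) '' Δ) where
  finite := Δ.toFinite.image _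
  simplicial := by
    rintro _ ⟨D, hD, rfl⟩
    exact PointedCone.IsSimplicial.hull (D.finite_toSet.image g) (h.linearIndepOn hD).id_image
  face_mem := by
    classical
    rintro _ ⟨D, hD, rfl⟩ F hF
    exact ⟨_, hdown D hD _ (Finset.filter_subset _ _), (eq_hull_of_isFaceOf hF).symm⟩
  inter_isFaceOf := by
    classical
    rintro _ ⟨D, hD, rfl⟩ _ ⟨D', hD', rfl⟩
    -- The intersection is spanned by the common generators: a point of both cones has a single
    -- coefficient vector, which vanishes outside `D` and outside `D'`.
    convert h.hull_isFaceOf hD (Finset.inter_subset_left (s₂ := D')) using 1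
    ext x
    dsimp only
    rw [Submodule.mem_inf, mem_hull_image_iff, mem_hull_image_iff, mem_hull_image_iff]
    constructor
    · rintro ⟨⟨w, hw, rfl⟩, w', hw', hsum⟩
      refine ⟨w, ⟨hw.1, fun e he => ?_⟩, rfl⟩
      by_cases heD : e ∈ D
      · rw [h D hD D' hD' w w' hw hw' hsum.symm]
        exact hw'.2 e fun h' => he (Finset.mem_inter.2 ⟨heD, h'⟩)
      · exact hw.2 e heD
    · rintro ⟨w, hw, rfl⟩
      exact ⟨⟨w, hw.mono Finset.inter_subset_left, rfl⟩, w, hw.mono Finset.inter_subset_right, rfl⟩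
  complete := by
    intro x
    obtain ⟨D, hD, hx⟩ := hcov x
    exact ⟨_, ⟨D, hD, rfl⟩, hx⟩

end Fan

/-! ### The faces of the Gröbner cone in the positive part -/

theorem separationVector_isolationMap (v : Edge n → ℝ) :
    separationVector (isolationMap n v) = v :=
  (separationEquiv n).apply_symm_apply v

theorem isolationMap_edgeGenerator (e : Edge n) :
    isolationMap n (edgeGenerator e) = Pi.single e 1 :=
  isolationMap_separationVector _

theorem separationVector_eq_sum (w : Edge n → ℝ) :
    separationVector w = ∑ e, w e • edgeGenerator e := by
  classical
  ext s
  rw [separationVector_apply, Finset.sum_apply]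
  refine Finset.sum_congr rfl fun e _ => ?_
  rw [Pi.smul_apply, edgeGenerator, separationVector_apply, Finset.sum_eq_single e]
  · simp
  · intro f _ hf
    simp [hf]
  · simp

theorem eq_sum_isolationMap (v : Edge n → ℝ) : v = ∑ e, isolationMap n v e • edgeGenerator e := by
  rw [← separationVector_eq_sum, separationVector_isolationMap]

theorem mem_grobnerCone_iff_isolationMap {v : Edge n → ℝ} :
    v ∈ grobnerCone 1 n ↔ ∀ e, IsRelevant 1 e → 0 ≤ isolationMap n v e := by
  rw [← separationVector_mem_grobnerCone_iff, separationVector_isolationMap]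

theorem mem_tropPfaffianPlus_iff_isolationMap {v : Edge n → ℝ} :
    v ∈ tropPfaffianPlus 1 n ↔ (∀ e, IsRelevant 1 e → 0 ≤ isolationMap n v e) ∧
      ∀ e f, Crosses e f → isolationMap n v e = 0 ∨ isolationMap n v f = 0 := by
  rw [← separationVector_mem_tropPfaffianPlus_iff, separationVector_isolationMap]

/-- The face of the Gröbner cone generated by the sides and by the diagonals in `D`. -/
noncomputable def coneOf (D : Finset (Edge n)) : PointedCone ℝ (Edge n → ℝ) where
  carrier := {v | ∀ e, IsRelevant 1 e → 0 ≤ isolationMap n v e ∧ (e ∉ D → isolationMap n v e = 0)}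
  add_mem' := by
    intro v w hv hw e he
    rw [map_add, Pi.add_apply]
    exact ⟨add_nonneg (hv e he).1 (hw e he).1, fun h => by
      rw [(hv e he).2 h, (hw e he).2 h, add_zero]⟩
  zero_mem' := by
    intro e _
    rw [map_zero]
    exact ⟨le_rfl, fun _ => rfl⟩
  smul_mem' := by
    intro c v hv e he
    have : isolationMap n (c • v) e = (c : ℝ) * isolationMap n v e :=
      congrFun (map_smul (isolationMap n) (c : ℝ) v) e
    rw [this]
    exact ⟨mul_nonneg c.2 (hv e he).1, fun h => by rw [(hv e he).2 h, mul_zero]⟩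

theorem mem_coneOf {D : Finset (Edge n)} {v : Edge n → ℝ} : v ∈ coneOf D ↔
    ∀ e, IsRelevant 1 e → 0 ≤ isolationMap n v e ∧ (e ∉ D → isolationMap n v e = 0) := Iff.rfl

theorem coneOf_isFaceOf (D : Finset (Edge n)) : (coneOf D).IsFaceOf (grobnerCone 1 n) where
  le v hv := mem_grobnerCone_iff_isolationMap.2 fun e he => (hv e he).1
  mem_of_smul_add_mem := by
    intro x y a hx hy ha hxy e he
    rw [mem_grobnerCone_iff_isolationMap] at hx hy
    refine ⟨hx e he, fun h => ?_⟩
    have h0 := (hxy e he).2 h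
    rw [map_add, map_smul, Pi.add_apply, Pi.smul_apply, smul_eq_mul] at h0
    have h1 := mul_nonneg ha.le (hx e he)
    have h2 := hy e he
    exact (mul_eq_zero.1 (by linarith : a * isolationMap n x e = 0)).resolve_left ha.ne'

theorem Crosses.isRelevant {e f : Edge n} (h : Crosses e f) : IsRelevant 1 e := by
  by_contra he
  exact not_crosses_of_not_isRelevant he f h

theorem mem_tropPfaffianPlus_of_mem_coneOf {D : Finset (Edge n)} (hD : IsFree 2 D)
    {v : Edge n → ℝ} (hv : v ∈ coneOf D) : v ∈ tropPfaffianPlus 1 n := by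
  refine mem_tropPfaffianPlus_iff_isolationMap.2 ⟨fun e he => (hv e he).1, fun e f hc => ?_⟩
  by_contra! h
  have h1 : e ∈ D := by
    by_contra hne
    exact h.1 ((hv e hc.isRelevant).2 hne)
  have h2 : f ∈ D := by
    by_contra hne
    exact h.2 ((hv f hc.symm.isRelevant).2 hne)
  exact isFree_two_iff.1 hD e h1 f h2 hc

theorem edgeGenerator_mem_grobnerCone (e : Edge n) : edgeGenerator e ∈ grobnerCone 1 n := by
  refine mem_grobnerCone_iff_isolationMap.2 fun f _ => ?_
  rw [isolationMap_edgeGenerator]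
  exact (isNonnegOn_single (Finset.mem_univ e)).1 f

theorem edgeGenerator_mem_coneOf {D : Finset (Edge n)} {e : Edge n} (he : e ∈ D) :
    edgeGenerator e ∈ coneOf D := by
  intro f _
  rw [isolationMap_edgeGenerator]
  exact ⟨(isNonnegOn_single he).1 f, (isNonnegOn_single he).2 f⟩

theorem neg_edgeGenerator_mem_grobnerCone {e : Edge n} (he : ¬ IsRelevant 1 e) :
    -edgeGenerator e ∈ grobnerCone 1 n := by
  refine mem_grobnerCone_iff_isolationMap.2 fun f hf => ?_
  rw [map_neg, isolationMap_edgeGenerator, Pi.neg_apply,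
    Pi.single_eq_of_ne (fun h : f = e => he (h ▸ hf)), neg_zero]

/-- Side generators lie in the Gröbner cone with both signs, hence in its lineality space, which
every face contains. -/
theorem smul_edgeGenerator_mem_of_isFaceOf {F : PointedCone ℝ (Edge n → ℝ)}
    (hF : F.IsFaceOf (grobnerCone 1 n)) {e : Edge n} (he : ¬ IsRelevant 1 e) (c : ℝ) :
    c • edgeGenerator e ∈ F := by
  have h0 : edgeGenerator e + -edgeGenerator e ∈ F := by
    rw [add_neg_cancel]
    exact F.zero_mem
  have h1 := edgeGenerator_mem_grobnerCone e
  have h2 := neg_edgeGenerator_mem_grobnerCone he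
  rcases le_total 0 c with hc | hc
  · exact PointedCone.smul_mem F hc (hF.mem_of_add_mem_left h1 h2 h0)
  · rw [← neg_smul_neg]
    exact PointedCone.smul_mem F (neg_nonneg.2 hc) (hF.mem_of_add_mem_right h1 h2 h0)

theorem exists_eq_coneOf {F : PointedCone ℝ (Edge n → ℝ)} (hF : F ∈ tropPfaffianPlusFan 1 n) :
    ∃ D : Finset (Edge n), (∀ e ∈ D, IsRelevant 1 e) ∧ IsFree 2 D ∧ F = coneOf D := by
  classical
  obtain ⟨hF, hsub⟩ := hF
  -- Two crossing members of `D` would give a vector of `F`, the sum of their generators, with two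
  -- crossing nonzero coefficients. Conversely, a positive diagonal coefficient of a vector in `F`
  -- puts that generator into `F` by the face property.
  let D := Finset.univ.filter fun e : Edge n => IsRelevant 1 e ∧ edgeGenerator e ∈ F
  have hD : ∀ e, e ∈ D ↔ IsRelevant 1 e ∧ edgeGenerator e ∈ F := fun e => by simp [D]
  refine ⟨D, fun e he => ((hD e).1 he).1, isFree_two_iff.2 fun e he f hf hc => ?_, ?_⟩
  · have h := (mem_tropPfaffianPlus_iff_isolationMap.1
      (hsub (F.add_mem ((hD e).1 he).2 ((hD f).1 hf).2))).2 e f hc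
    have hne : e ≠ f := fun heq => not_crosses_self f (heq ▸ hc)
    simp [isolationMap_edgeGenerator, hne, hne.symm] at h
  · refine le_antisymm (fun v hv e he => ?_) fun v hv => ?_
    · have hG := mem_grobnerCone_iff_isolationMap.1 (hF.le hv)
      refine ⟨hG e he, fun hne => ?_⟩
      by_contra h0
      refine hne ((hD e).2 ⟨he, ?_⟩)
      have hrest : ∑ f ∈ Finset.univ.erase e, isolationMap n v f • edgeGenerator f ∈
          grobnerCone 1 n := Submodule.sum_mem _ fun f _ => by
        by_cases hf : IsRelevant 1 f
        · exact PointedCone.smul_mem _ (hG f hf) (edgeGenerator_mem_grobnerCone f)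
        · exact smul_edgeGenerator_mem_of_isFaceOf .rfl hf _
      refine hF.mem_of_smul_add_mem (edgeGenerator_mem_grobnerCone e) hrest
        (lt_of_le_of_ne (hG e he) (Ne.symm h0)) ?_
      rw [Finset.add_sum_erase Finset.univ (fun f => isolationMap n v f • edgeGenerator f)
        (Finset.mem_univ e), ← eq_sum_isolationMap]
      exact hv
    · rw [eq_sum_isolationMap v]
      refine Submodule.sum_mem _ fun e _ => ?_
      by_cases he : IsRelevant 1 e
      · by_cases heD : e ∈ D
        · exact PointedCone.smul_mem _ (hv e he).1 ((hD e).1 heD).2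
        · rw [(hv e he).2 heD, zero_smul]
          exact F.zero_mem
      · exact smul_edgeGenerator_mem_of_isFaceOf hF he _

theorem coneOf_mem_tropPfaffianPlusFan {D : Finset (Edge n)} (hD : IsFree 2 D) :
    coneOf D ∈ tropPfaffianPlusFan 1 n :=
  ⟨coneOf_isFaceOf D, fun _ hv => mem_tropPfaffianPlus_of_mem_coneOf hD hv⟩

theorem exists_mem_coneOf {v : Edge n → ℝ} (hv : v ∈ tropPfaffianPlus 1 n) :
    ∃ D : Finset (Edge n), (∀ e ∈ D, IsRelevant 1 e) ∧ IsFree 2 D ∧ v ∈ coneOf D := by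
  classical
  obtain ⟨h1, h2⟩ := mem_tropPfaffianPlus_iff_isolationMap.1 hv
  refine ⟨Finset.univ.filter fun e => IsRelevant 1 e ∧ isolationMap n v e ≠ 0, fun e he => ?_,
    isFree_two_iff.2 fun e he f hf hc => ?_, fun e he => ⟨h1 e he, fun hne => ?_⟩⟩
  · exact (Finset.mem_filter.1 he).2.1
  · exact (h2 e f hc).elim (Finset.mem_filter.1 he).2.2 (Finset.mem_filter.1 hf).2.2
  · by_contra h0
    exact hne (Finset.mem_filter.2 ⟨Finset.mem_univ e, he, h0⟩)

theorem iUnion_tropPfaffianPlusFan :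
    (⋃ F ∈ tropPfaffianPlusFan 1 n, (F : Set (Edge n → ℝ))) = tropPfaffianPlus 1 n := by
  refine Set.Subset.antisymm (Set.iUnion₂_subset fun F hF => hF.2) fun v hv => ?_
  obtain ⟨D, -, hD, hvD⟩ := exists_mem_coneOf hv
  exact Set.mem_iUnion₂.2 ⟨coneOf D, coneOf_mem_tropPfaffianPlusFan hD, hvD⟩

theorem map_coneOf {V : Type*} [AddCommGroup V] [Module ℝ V] (f : (Edge n → ℝ) →ₗ[ℝ] V)
    (hf : ∀ e : Edge n, ¬ IsRelevant 1 e → f (edgeGenerator e) = 0) (D : Finset (Edge n)) :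
    PointedCone.map f (coneOf D) =
      PointedCone.hull ℝ ((fun e => f (edgeGenerator e)) '' (D : Set (Edge n))) := by
  refine le_antisymm ?_ (Submodule.span_le.2 ?_)
  · rintro _ ⟨v, hv, rfl⟩
    have hv : v ∈ coneOf D := hv
    have : f v = ∑ e, isolationMap n v e • f (edgeGenerator e) := by
      conv_lhs => rw [eq_sum_isolationMap v, map_sum]
      simp only [map_smul]
    change f v ∈ _
    rw [this]
    refine Submodule.sum_mem _ fun e _ => ?_
    by_cases he : IsRelevant 1 e
    · by_cases heD : e ∈ D
      · exact PointedCone.smul_mem _ (hv e he).1 (PointedCone.subset_hull ⟨e, heD, rfl⟩)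
      · rw [(hv e he).2 heD, zero_smul]
        exact Submodule.zero_mem _
    · rw [hf e he, smul_zero]
      exact Submodule.zero_mem _
  · rintro _ ⟨e, he, rfl⟩
    exact PointedCone.mem_map.2 ⟨_, edgeGenerator_mem_coneOf he, rfl⟩

theorem map_image_tropPfaffianPlusFan {V : Type*} [AddCommGroup V] [Module ℝ V]
    (f : (Edge n → ℝ) →ₗ[ℝ] V)
    (hf : ∀ e : Edge n, ¬ IsRelevant 1 e → f (edgeGenerator e) = 0) :
    PointedCone.map f '' tropPfaffianPlusFan 1 n =
      (fun D : Finset (Edge n) => PointedCone.hull ℝ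
        ((fun e => f (edgeGenerator e)) '' (D : Set (Edge n)))) ''
          {D | (∀ e ∈ D, IsRelevant 1 e) ∧ IsFree 2 D} := by
  ext C
  constructor
  · rintro ⟨F, hF, rfl⟩
    obtain ⟨D, h1, h2, rfl⟩ := exists_eq_coneOf hF
    exact ⟨D, ⟨h1, h2⟩, (map_coneOf f hf D).symm⟩
  · rintro ⟨D, ⟨-, hD⟩, rfl⟩
    exact ⟨coneOf D, coneOf_mem_tropPfaffianPlusFan hD, map_coneOf f hf D⟩

/-! ### Coordinates on a triangulation -/

theorem injOn_coordProj (hn : 3 ≤ n) {T : Finset (Edge n)} (hT : IsTriangulation 1 T) :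
    Set.InjOn (coordProj T) (tropPfaffianPlus 1 n) := by
  intro v hv v' hv' h
  ext e
  have := hT.isTriangulationOf_univ.ptolemy_unique
    (by rw [Finset.card_univ, Fintype.card_fin]; omega) (symm_comm v) (symm_comm v')
    (mem_tropPfaffianPlus_iff.1 hv) (mem_tropPfaffianPlus_iff.1 hv') (fun f hf => by
      rw [symm_of_lt v f.2, symm_of_lt v' f.2]
      exact congrFun h ⟨f, hf⟩) _ (Finset.mem_univ e.1.1) _ (Finset.mem_univ e.1.2) e.2.ne
  rwa [symm_of_lt v e.2, symm_of_lt v' e.2] at this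

theorem exists_coordProj_eq (hn : 3 ≤ n) {T : Finset (Edge n)} (hT : IsTriangulation 1 T)
    (x : T → ℝ) : ∃ v ∈ tropPfaffianPlus 1 n, coordProj T v = x := by
  classical
  obtain ⟨d, -, hP, hd⟩ := hT.isTriangulationOf_univ.exists_ptolemy
    (by rw [Finset.card_univ, Fintype.card_fin]; omega)
    (fun e => if h : e ∈ T then x ⟨e, h⟩ else 0)
  let v : Edge n → ℝ := fun e => d e.1.1 e.1.2
  have hs : ∀ {i j}, i < j → symm v i j = d i j := fun h => symm_of_lt v h
  refine ⟨v, mem_tropPfaffianPlus_iff.2 fun i hi j hj k hk l hl hij hjk hkl => ?_, ?_⟩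
  · unfold Ptolemy
    rw [hs hij, hs hkl, hs hjk, hs (hij.trans hjk), hs (hjk.trans hkl),
      hs ((hij.trans hjk).trans hkl)]
    exact hP i hi j hj k hk l hl hij hjk hkl
  · ext ⟨e, he⟩
    have := hd e he
    rw [dif_pos he] at this
    exact this

/-- Coefficient vectors that agree after projecting the separation vectors to a triangulation. -/
theorem eq_of_coordProj_separationVector_eq (hn : 3 ≤ n) {T : Finset (Edge n)}
    (hT : IsTriangulation 1 T) {D D' : Finset (Edge n)} (hD : IsFree 2 D) (hD' : IsFree 2 D')
    {w w' : Edge n → ℝ} (hw : ∀ e, IsRelevant 1 e → 0 ≤ w e ∧ (e ∉ D → w e = 0))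
    (hw' : ∀ e, IsRelevant 1 e → 0 ≤ w' e ∧ (e ∉ D' → w' e = 0))
    (h : coordProj T (separationVector w) = coordProj T (separationVector w')) : w = w' := by
  have h1 : separationVector w ∈ tropPfaffianPlus 1 n :=
    mem_tropPfaffianPlus_of_mem_coneOf hD (by
      rw [mem_coneOf, isolationMap_separationVector]
      exact hw)
  have h2 : separationVector w' ∈ tropPfaffianPlus 1 n :=
    mem_tropPfaffianPlus_of_mem_coneOf hD' (by
      rw [mem_coneOf, isolationMap_separationVector]
      exact hw')
  exact (separationEquiv n).injective (injOn_coordProj hn hT h1 h2 h)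

/-- Functions supported on a set of edges, projected to a triangulation by way of separation
vectors. -/
noncomputable def separationProj (T : Finset (Edge n)) (p : Edge n → Prop) :
    ({e // p e} → ℝ) →ₗ[ℝ] (T → ℝ) :=
  coordProj T ∘ₗ separationMap n ∘ₗ Function.ExtendByZero.linearMap ℝ Subtype.val

theorem separationProj_apply (T : Finset (Edge n)) (p : Edge n → Prop) (z : {e // p e} → ℝ) :
    separationProj T p z = coordProj T (separationVector (Function.extend Subtype.val z 0)) := rfl

theorem separationProj_single (T : Finset (Edge n)) (p : Edge n → Prop) [DecidablePred p]
    (e : {e // p e}) :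
    separationProj T p (Pi.single e 1) = coordProj T (edgeGenerator e.1) := by
  rw [separationProj_apply, edgeGenerator]
  congr 2
  ext f
  by_cases hf : p f
  · have := Subtype.val_injective.extend_apply (Pi.single e (1 : ℝ)) (0 : Edge n → ℝ) ⟨f, hf⟩
    rw [this]
    by_cases hfe : f = e.1
    · subst hfe
      simp
    · rw [Pi.single_eq_of_ne hfe, Pi.single_eq_of_ne (fun h => hfe (congrArg Subtype.val h))]
  · rw [Function.extend_apply' _ _ _ (by simpa using hf),
      Pi.single_eq_of_ne (fun h : f = e.1 => hf (by rw [h]; exact e.2)), Pi.zero_apply]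

/-- Applied to the edges of `T` this yields a basis of the coordinate space of `T`; applied to the
sides it yields their independence. -/
theorem separationProj_injective (hn : 3 ≤ n) {T : Finset (Edge n)} (hT : IsTriangulation 1 T)
    {D : Finset (Edge n)} (hD : IsFree 2 D) {p : Edge n → Prop}
    (hp : ∀ e, p e → IsRelevant 1 e → e ∈ D) : Function.Injective (separationProj T p) := by
  classical
  rw [injective_iff_map_eq_zero]
  intro z hz
  let u : Edge n → ℝ := Function.extend Subtype.val z 0
  -- Diagonal coefficients are split into positive and negative parts, both supported on the
  -- non-crossing set `D`. Side coefficients may have any sign and stay in `w`.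
  let w : Edge n → ℝ := fun e => if IsRelevant 1 e then max (u e) 0 else u e
  let w' : Edge n → ℝ := fun e => if IsRelevant 1 e then max (-u e) 0 else 0
  have hu : ∀ e, IsRelevant 1 e → e ∉ D → u e = 0 := fun e he hne =>
    Function.extend_apply' _ _ _ (by
      rintro ⟨⟨f, hf⟩, rfl⟩
      exact hne (hp f hf he))
  have huw : u = w - w' := by
    ext e
    simp only [w, w', Pi.sub_apply]
    split_ifs
    · rcases le_total (u e) 0 with h0 | h0
      · rw [max_eq_right h0, max_eq_left (by linarith)]
        ring
      · rw [max_eq_left h0, max_eq_right (by linarith)]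
        ring
    · ring
  have heq : w = w' := by
    refine eq_of_coordProj_separationVector_eq hn hT hD hD (fun e he => ?_) (fun e he => ?_) ?_
    · simp only [w, if_pos he]
      exact ⟨le_max_right _ _, fun hne => by simp [hu e he hne]⟩
    · simp only [w', if_pos he]
      exact ⟨le_max_right _ _, fun hne => by simp [hu e he hne]⟩
    · have h0 : coordProj T (separationMap n u) = 0 := hz
      rw [huw, map_sub, map_sub, sub_eq_zero] at h0
      exact h0
  ext e
  have : u e.1 = z e := Subtype.val_injective.extend_apply _ _ e
  rw [← this, huw, heq, sub_self]
  rfl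

theorem existsUnique_seed_map (hn : 3 ≤ n) {T : Finset (Edge n)} (hT : IsTriangulation 1 T) :
    ∃! φ : (T → ℝ) →ₗ[ℝ] (relevantPart 1 T → ℝ),
      (∀ e : Edge n, ¬ IsRelevant 1 e → φ (coordProj T (edgeGenerator e)) = 0) ∧
      ∀ δ : relevantPart 1 T, φ (coordProj T (edgeGenerator δ.1)) = Pi.single δ 1 := by
  classical
  have hinj := separationProj_injective hn hT hT.1 (p := (· ∈ T)) fun e he _ => he
  -- The projected generators of the edges of `T` form a basis, with `A` as change of basis. The
  -- required map reads off the diagonal coordinates in it, and its values on this basis are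
  -- prescribed.
  let A : (T → ℝ) ≃ₗ[ℝ] (T → ℝ) := LinearEquiv.ofInjectiveEndo (separationProj T (· ∈ T)) hinj
  have hA : ∀ e : T, A (Pi.single e 1) = coordProj T (edgeGenerator e.1) :=
    separationProj_single T (· ∈ T)
  have hmem : ∀ δ : relevantPart 1 T, δ.1 ∈ T := fun δ => (Finset.mem_filter.1 δ.2).1
  let incl : relevantPart 1 T → T := fun δ => ⟨δ.1, hmem δ⟩
  have hval : ∀ e : T, (LinearMap.funLeft ℝ ℝ incl ∘ₗ A.symm.toLinearMap)
      (coordProj T (edgeGenerator e.1)) = fun δ => (Pi.single e (1 : ℝ) : T → ℝ) (incl δ) :=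
    fun e => by
      rw [← hA e]
      ext δ
      simp [LinearMap.funLeft_apply]
  refine ⟨LinearMap.funLeft ℝ ℝ incl ∘ₗ A.symm.toLinearMap, ⟨fun e he => ?_, fun δ => ?_⟩, ?_⟩
  · have heT := hT.mem_of_not_isRelevant he
    rw [hval ⟨e, heT⟩]
    ext δ
    refine Pi.single_eq_of_ne (fun h => he ?_) _
    have h : δ.1 = e := congrArg Subtype.val h
    rw [← h]
    exact (Finset.mem_filter.1 δ.2).2
  · rw [hval (incl δ)]
    ext δ'
    by_cases h : δ' = δ
    · subst h
      simp
    · rw [Pi.single_eq_of_ne h, Pi.single_eq_of_ne]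
      exact fun h' : incl δ' = incl δ => h (Subtype.ext (congrArg Subtype.val h' :))
  · rintro ψ ⟨h1, h2⟩
    have hext : ψ ∘ₗ A.toLinearMap = LinearMap.funLeft ℝ ℝ incl := by
      refine (Pi.basisFun ℝ T).ext fun e => ?_
      rw [Pi.basisFun_apply, LinearMap.comp_apply, LinearEquiv.coe_coe, hA e]
      by_cases he : IsRelevant 1 e.1
      · have := h2 ⟨e.1, Finset.mem_filter.2 ⟨e.2, he⟩⟩
        rw [this]
        ext δ
        rw [LinearMap.funLeft_apply]
        by_cases h : δ.1 = e.1
        · obtain rfl : e = incl δ := Subtype.ext h.symm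
          simp [incl]
        · rw [Pi.single_eq_of_ne fun h' => h (congrArg Subtype.val h'),
            Pi.single_eq_of_ne fun h' => h (congrArg Subtype.val h')]
      · rw [h1 e.1 he]
        ext δ
        rw [LinearMap.funLeft_apply, Pi.single_eq_of_ne, Pi.zero_apply]
        rintro rfl
        exact he (Finset.mem_filter.1 δ.2).2
    rw [← hext]
    ext x
    simp

/-- A surjection onto the diagonal coordinates that kills the sides has no larger kernel. -/
theorem exists_of_map_eq_zero (hn : 3 ≤ n) {T : Finset (Edge n)} (hT : IsTriangulation 1 T)
    {φ : (T → ℝ) →ₗ[ℝ] (relevantPart 1 T → ℝ)} (hφ : Function.Surjective φ)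
    (hside : ∀ e : Edge n, ¬ IsRelevant 1 e → φ (coordProj T (edgeGenerator e)) = 0)
    {x : T → ℝ} (hx : φ x = 0) :
    ∃ z : Edge n → ℝ, (∀ e, IsRelevant 1 e → z e = 0) ∧ coordProj T (separationVector z) = x := by
  classical
  have hinj := separationProj_injective hn hT hT.1 (p := fun e => ¬ IsRelevant 1 e)
    fun e he he' => absurd he' he
  have hle : LinearMap.range (separationProj T fun e => ¬ IsRelevant 1 e) ≤ LinearMap.ker φ := by
    rw [LinearMap.range_le_ker_iff]
    refine (Pi.basisFun ℝ _).ext fun e => ?_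
    rw [Pi.basisFun_apply, LinearMap.comp_apply, separationProj_single, hside e.1 e.2]
    rfl
  -- Both dimensions are `n`: the number of sides, and `(2n - 3) - (n - 3)`.
  have hrank : Module.finrank ℝ (LinearMap.range (separationProj T fun e => ¬ IsRelevant 1 e)) =
      Module.finrank ℝ (LinearMap.ker φ) := by
    have h1 := LinearMap.finrank_range_add_finrank_ker φ
    rw [LinearMap.finrank_range_of_inj hinj]
    rw [LinearMap.range_eq_top.2 hφ, finrank_top, Module.finrank_fintype_fun_eq_card,
      Module.finrank_fintype_fun_eq_card, Fintype.card_coe, Fintype.card_coe] at h1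
    rw [Module.finrank_fintype_fun_eq_card, Fintype.card_subtype, card_not_isRelevant hn]
    have h2 := hT.card_add_three hn
    have h3 := hT.card_relevantPart hn
    omega
  have heq := Submodule.eq_of_le_of_finrank_eq hle hrank
  have hmem : x ∈ LinearMap.range (separationProj T fun e => ¬ IsRelevant 1 e) := by
    rw [heq]
    exact hx
  obtain ⟨z, rfl⟩ := hmem
  refine ⟨_, fun e he => ?_, (separationProj_apply _ _ z).symm⟩
  exact Function.extend_apply' _ _ _ (by
    rintro ⟨⟨f, hf⟩, rfl⟩
    exact hf he)

theorem hasUniqueConicRep (hn : 3 ≤ n) {T : Finset (Edge n)} (hT : IsTriangulation 1 T)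
    {φ : (T → ℝ) →ₗ[ℝ] (relevantPart 1 T → ℝ)} (hφ : Function.Surjective φ)
    (hside : ∀ e : Edge n, ¬ IsRelevant 1 e → φ (coordProj T (edgeGenerator e)) = 0) :
    HasUniqueConicRep (fun e => φ (coordProj T (edgeGenerator e)))
      {D | (∀ e ∈ D, IsRelevant 1 e) ∧ IsFree 2 D} := by
  rintro D ⟨hDr, hD⟩ D' ⟨hDr', hD'⟩ w w' hw hw' h
  have hsum : ∀ u : Edge n → ℝ, ∑ e, u e • φ (coordProj T (edgeGenerator e)) =
      φ (coordProj T (separationMap n u)) := fun u => by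
    have : separationMap n u = _ := separationVector_eq_sum u
    rw [this]
    simp only [map_sum, map_smul]
  rw [hsum, hsum, ← sub_eq_zero, ← map_sub, ← map_sub, ← map_sub] at h
  obtain ⟨z, hz, hzT⟩ := exists_of_map_eq_zero hn hT hφ hside h
  have hzT : coordProj T (separationMap n z) = coordProj T (separationMap n (w - w')) := hzT
  -- Adding the side combination `z` keeps `w'` admissible, so injectivity on the positive part
  -- applies. Off the sides `z` vanishes, and on the sides `w` and `w'` do.
  have heq : w = z + w' := by
    refine eq_of_coordProj_separationVector_eq hn hT hD hD' (fun e _ => ⟨hw.1 e, hw.2 e⟩)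
      (fun e he => ?_) ?_
    · rw [Pi.add_apply, hz e he, zero_add]
      exact ⟨hw'.1 e, hw'.2 e⟩
    · change coordProj T (separationMap n w) = coordProj T (separationMap n (z + w'))
      rw [map_add, map_add, hzT, ← map_add, ← map_add, sub_add_cancel]
  ext e
  by_cases he : IsRelevant 1 e
  · rw [heq, Pi.add_apply, hz e he, zero_add]
  · rw [hw.2 e fun h => he (hDr e h), hw'.2 e fun h => he (hDr' e h)]

theorem exists_mem_hull (hn : 3 ≤ n) {T : Finset (Edge n)} (hT : IsTriangulation 1 T)
    {φ : (T → ℝ) →ₗ[ℝ] (relevantPart 1 T → ℝ)} (hφ : Function.Surjective φ)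
    (hside : ∀ e : Edge n, ¬ IsRelevant 1 e → φ (coordProj T (edgeGenerator e)) = 0)
    (x : relevantPart 1 T → ℝ) :
    ∃ D ∈ {D : Finset (Edge n) | (∀ e ∈ D, IsRelevant 1 e) ∧ IsFree 2 D},
      x ∈ PointedCone.hull ℝ
        ((fun e => φ (coordProj T (edgeGenerator e))) '' (D : Set (Edge n))) := by
  obtain ⟨y, rfl⟩ := hφ x
  obtain ⟨v, hv, rfl⟩ := exists_coordProj_eq hn hT y
  obtain ⟨D, h1, h2, hvD⟩ := exists_mem_coneOf hv
  refine ⟨D, ⟨h1, h2⟩, ?_⟩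
  have := map_coneOf (φ ∘ₗ coordProj T) hside D
  simp only [LinearMap.comp_apply] at this
  rw [← this]
  exact PointedCone.mem_map.2 ⟨v, hvD, rfl⟩

end PfaffianFan

/-! ### Assembly of the theorem. -/

theorem mainTheorem10 (n : ℕ) (hn : 3 ≤ n) (T : Finset (PfaffianFan.Edge n))
    (hT : PfaffianFan.IsTriangulation 1 T) :
    -- the projection to the `2n - 3` coordinates in the seed triangulation is injective
    T.card + 3 = 2 * n ∧
    Set.InjOn (PfaffianFan.coordProj T) (PfaffianFan.tropPfaffianPlus 1 n) ∧
    -- the positive part is the union of the faces of the Gröbner cone that it contains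
    (⋃ F ∈ PfaffianFan.tropPfaffianPlusFan 1 n, (F : Set (PfaffianFan.Edge n → ℝ))) =
      PfaffianFan.tropPfaffianPlus 1 n ∧
    -- there are `n - 3` diagonals in `T`, and there is exactly one linear map to the space of
    -- diagonal coordinates that kills the irrelevant face and is normalized on the diagonals of `T`
    (PfaffianFan.relevantPart 1 T).card + 3 = n ∧
    (∃! φ : (T → ℝ) →ₗ[ℝ] (PfaffianFan.relevantPart 1 T → ℝ),
      (∀ e : PfaffianFan.Edge n, ¬ PfaffianFan.IsRelevant 1 e →
        φ (PfaffianFan.coordProj T (PfaffianFan.edgeGenerator e)) = 0) ∧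
      ∀ δ : PfaffianFan.relevantPart 1 T,
        φ (PfaffianFan.coordProj T (PfaffianFan.edgeGenerator δ.1)) = Pi.single δ 1) ∧
    -- every linear projection to that space that kills the irrelevant face realizes the
    -- associahedron as a complete simplicial fan
    ∀ φ : (T → ℝ) →ₗ[ℝ] (PfaffianFan.relevantPart 1 T → ℝ), Function.Surjective φ →
      (∀ e : PfaffianFan.Edge n, ¬ PfaffianFan.IsRelevant 1 e →
        φ (PfaffianFan.coordProj T (PfaffianFan.edgeGenerator e)) = 0) →
      PfaffianFan.IsCompleteSimplicialFan
        (PointedCone.map (φ ∘ₗ PfaffianFan.coordProj T) ''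
          PfaffianFan.tropPfaffianPlusFan 1 n) ∧
      ∃ Ψ : PfaffianFan.Associahedron 1 n ≃o
          ↥(PointedCone.map (φ ∘ₗ PfaffianFan.coordProj T) ''
            PfaffianFan.tropPfaffianPlusFan 1 n),
        ∀ D : PfaffianFan.Associahedron 1 n,
          (Ψ D : PointedCone ℝ (PfaffianFan.relevantPart 1 T → ℝ)) =
            PointedCone.hull ℝ ((fun e => φ (PfaffianFan.coordProj T
              (PfaffianFan.edgeGenerator e))) '' (D.1 : Set (PfaffianFan.Edge n))) := by
  refine ⟨hT.card_add_three hn, PfaffianFan.injOn_coordProj hn hT,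
    PfaffianFan.iUnion_tropPfaffianPlusFan, hT.card_relevantPart hn,
    PfaffianFan.existsUnique_seed_map hn hT, fun φ hφ hside => ?_⟩
  have hfan := PfaffianFan.map_image_tropPfaffianPlusFan (φ ∘ₗ PfaffianFan.coordProj T) hside
  have hu := PfaffianFan.hasUniqueConicRep hn hT hφ hside
  refine ⟨?_, ?_⟩
  · rw [hfan]
    refine hu.isCompleteSimplicialFan (fun D hD D' hs => ⟨fun e he => hD.1 e (hs he), ?_⟩)
      (PfaffianFan.exists_mem_hull hn hT hφ hside)
    exact fun R hR => hD.2 R (hR.trans hs)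
  · rw [hfan]
    let f : PfaffianFan.Associahedron 1 n →
        ↥((fun D : Finset (PfaffianFan.Edge n) => PointedCone.hull ℝ
          ((fun e => (φ ∘ₗ PfaffianFan.coordProj T) (PfaffianFan.edgeGenerator e)) ''
            (D : Set (PfaffianFan.Edge n)))) ''
          {D | (∀ e ∈ D, PfaffianFan.IsRelevant 1 e) ∧ PfaffianFan.IsFree 2 D}) :=
      fun D => ⟨_, D.1, D.2, rfl⟩
    have hle : ∀ D D', f D ≤ f D' ↔ D ≤ D' := fun D D' => hu.hull_le_hull_iff D.2 D'.2
    have hinj : Function.Injective f := fun D D' h =>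
      le_antisymm ((hle D D').1 h.le) ((hle D' D).1 h.ge)
    have hsurj : Function.Surjective f := by
      rintro ⟨_, D, hD, rfl⟩
      exact ⟨⟨D, hD⟩, rfl⟩
    exact ⟨⟨Equiv.ofBijective f ⟨hinj, hsurj⟩, fun {D D'} => hle D D'⟩, fun D => rfl⟩
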